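/- Notation. For $m\ge 1$ and a compact convex set $K$ in an $m$-dimensional Euclidean space, the quermassintegrals $W^{(m)}_0(K),\dots,W^{(m)}_m(K)$ are the numbers determined by $$\mathcal H^m(K+\rho B)=\sum_{j=0}^m\binom mj W^{(m)}_j(K)\,\rho^j\qquad(\rho\ge 0),$$ where $B$ is the closed unit ball and $\mathcal H^m$ is Lebesgue measure (so $W^{(m)}_j(\emptyset)=0$). Let $\kappa_m$ be the volume of the unit ball of $\mathbb R^m$. Let $\mathcal Q^n$ be the class of functions $f:\mathbb R^n\to[0,+\infty]$, $f\not\equiv 0$, that are quasi-concave (i.e. $f((1-\lambda)x+\lambda y)\ge\min\{f(x),f(y)\}$ for all $x,y\in\mathbb R^n$ and $\lambda\in[0,1]$), upper semicontinuous, and satisfy $f(x)\to 0$ as $\|x\|\to\infty$. For a function $f$ with values in $[0,+\infty]$ on an $m$-dimensional Euclidean space put $$W^{(m)}_j(f)=\int_0^{+\infty}W^{(m)}_j(\{f\ge t\})\,dt\in[0,+\infty],$$ whenever the sets $\{f\ge t\}$, $t>0$, are compact and convex. For a linear subspace $L\subseteq\mathbb R^n$ let $K|L$ be the orthogonal projection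 of $K\subseteq\mathbb R^n$ onto $L$, and for $f\in\mathcal Q^n$ let $f|L:L\to[0,+\infty]$, $(f|L)(x')=\sup\{f(x'+y): y\in L^\perp\}$. Let $\mathcal L^n_k$ be the set of $k$-dimensional linear subspaces of $\mathbb R^n$, and let $dL$ denote integration with respect to its rotation invariant probability measure. Theorem (Cauchy–Kubota formula for quasi-concave functions). Let $n,k,i$ be integers with $0\le i\le k\le n$ and $k\ge 1$, and let $c=\kappa_n/\kappa_k$, the constant of the classical Cauchy–Kubota formula: for every non-empty compact convex set $K\subset\mathbb R^n$ the function $L\mapsto W^{(k)}_{k-i}(K|L)$ is integrable on $\mathcal L^n_k$ and $$W^{(n)}_{n-i}(K)=c\int_{\mathcal L^n_k}W^{(k)}_{k-i}(K|L)\,dL .$$ Then, with the same constant, for every $f\in\mathcal Q^n$ the function $L\mapsto W^{(k)}_{k-i}(f|L)\in[0,+\infty]$ is measurable (up to null sets) on $\mathcal L^n_k$ and $$W^{(n)}_{n-i}(f)=c\int_{\mathcal L^n_k}W^{(k)}_{k-i}(f|L)\,dL .$$ Both the formula for convex sets and the formula for functions are part of the assertion. -/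

import Mathlib

open MeasureTheory Set Topology Module Filter
open scoped ENNReal Pointwise

noncomputable section

namespace Kubota

/-! ### Quermassintegrals of sets -/

section Quermass

variable {E : Type*} [NormedAddCommGroup E] [InnerProductSpace ℝ E] [FiniteDimensional ℝ E]
  [MeasurableSpace E] [BorelSpace E]

/-- `p` is the Steiner polynomial of `K`: the volume (Lebesgue measure of the Euclidean space `E`)
of the Minkowski sum `K + ρ B`, with `B` the closed unit ball, equals `p ρ` for all `ρ ≥ 0`. -/
def IsSteinerPolynomial (K : Set E) (p : Polynomial ℝ) : Prop :=
  ∀ ρ : ℝ, 0 ≤ ρ → (volume (K + ρ • Metric.closedBall (0 : E) 1)).toReal = p.eval ρ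

open Classical in
/-- The `i`-th quermassintegral of a set `K` in the Euclidean space `E` of dimension `m`: writing
the volume of `K + ρ B` as `∑_{i=0}^m (m choose i) W_i(K) ρ ^ i`, the number `W_i(K)`. -/
def quermass (i : ℕ) (K : Set E) : ℝ :=
  if h : ∃ p : Polynomial ℝ, IsSteinerPolynomial K p then
    (Classical.choose h).coeff i / ((finrank ℝ E).choose i : ℝ)
  else 0

theorem IsSteinerPolynomial.unique {K : Set E} {p q : Polynomial ℝ}
    (hp : IsSteinerPolynomial K p) (hq : IsSteinerPolynomial K q) : p = q := by
  refine Polynomial.eq_of_infinite_eval_eq p q ((Set.Ici_infinite (0 : ℝ)).mono ?_)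
  intro ρ hρ
  exact (hp ρ hρ).symm.trans (hq ρ hρ)

theorem quermass_eq {K : Set E} {p : Polynomial ℝ} (hp : IsSteinerPolynomial K p) (i : ℕ) :
    quermass i K = p.coeff i / ((finrank ℝ E).choose i : ℝ) := by
  have h : ∃ p : Polynomial ℝ, IsSteinerPolynomial K p := ⟨p, hp⟩
  rw [quermass, dif_pos h, (Classical.choose_spec h).unique hp]

/-! ### Quasi-concave functions and their quermassintegrals -/

/-- The class of functions `f : E → [0, ∞]`, not identically zero, quasi-concave, upper
semicontinuous, with `f x → 0` as `‖x‖ → ∞`. -/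
structure IsAdmissible (f : E → ℝ≥0∞) : Prop where
  ne_zero : f ≠ 0
  quasiconcave : ∀ x y : E, ∀ l : ℝ, 0 ≤ l → l ≤ 1 → min (f x) (f y) ≤ f ((1 - l) • x + l • y)
  upperSemicontinuous : UpperSemicontinuous f
  tendsto_zero : Tendsto f (cocompact E) (𝓝 0)

/-- The `i`-th quermassintegral `∫_0^∞ W_i({f ≥ t}) dt` of a function, with values in `[0, ∞]`. -/
def quermassFun (i : ℕ) (f : E → ℝ≥0∞) : ℝ≥0∞ :=
  ∫⁻ t in Ioi (0 : ℝ), ENNReal.ofReal (quermass i {x | ENNReal.ofReal t ≤ f x})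

/-- The orthogonal projection of a function onto a subspace:
`(f|L)(x') = sup {f (x' + y) : y ∈ Lᗮ}` for `x' ∈ L`. -/
def projFun (L : Submodule ℝ E) (f : E → ℝ≥0∞) : L → ℝ≥0∞ :=
  fun x => ⨆ y : Lᗮ, f ((x : E) + (y : E))

/-- The orthogonal projection of a set onto a subspace, as a subset of the subspace. -/
def projSet (L : Submodule ℝ E) (K : Set E) : Set L :=
  L.orthogonalProjectionOnto '' K

end Quermass

/-! ### The Grassmannian with its invariant probability measure -/

/-- The set of `k`-dimensional linear subspaces of `ℝⁿ`. -/
def Grass (n k : ℕ) : Type :=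
  {L : Submodule ℝ (EuclideanSpace ℝ (Fin n)) // finrank ℝ L = k}

/-- The usual topology: subspaces are identified with their orthogonal projections. -/
instance (n k : ℕ) : TopologicalSpace (Grass n k) :=
  TopologicalSpace.induced
    (fun L => (L.1.starProjection :
      EuclideanSpace ℝ (Fin n) →L[ℝ] EuclideanSpace ℝ (Fin n))) inferInstance

instance (n k : ℕ) : MeasurableSpace (Grass n k) := borel _

instance (n k : ℕ) : BorelSpace (Grass n k) := ⟨rfl⟩

/-- The orthogonal group `O(n)` of the Euclidean space `ℝⁿ`. -/
abbrev OrthGroup (n : ℕ) : Type :=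
  unitary (EuclideanSpace ℝ (Fin n) →L[ℝ] EuclideanSpace ℝ (Fin n))

/-- Taking adjoints is continuous. -/
instance (n : ℕ) :
    ContinuousStar (EuclideanSpace ℝ (Fin n) →L[ℝ] EuclideanSpace ℝ (Fin n)) :=
  ⟨(ContinuousLinearMap.adjoint (𝕜 := ℝ) (E := EuclideanSpace ℝ (Fin n))
    (F := EuclideanSpace ℝ (Fin n))).continuous⟩

instance (n : ℕ) : CompactSpace (OrthGroup n) := by
  refine isCompact_iff_compactSpace.mp (Metric.isCompact_of_isClosed_isBounded ?_ ?_)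
  · exact isClosed_unitary
  · refine (Metric.isBounded_closedBall (x := 0) (r := 1)).subset ?_
    intro u hu
    rw [mem_closedBall_zero_iff]
    refine ContinuousLinearMap.opNorm_le_bound _ zero_le_one fun x => ?_
    have := (Unitary.linearIsometryEquiv ⟨u, hu⟩).norm_map x
    rw [one_mul]
    exact this.le

/-- The Haar probability measure on `O(n)`. -/
def orthHaar (n : ℕ) : Measure (OrthGroup n) :=
  Measure.haarMeasure ⊤

instance (n : ℕ) : IsProbabilityMeasure (orthHaar n) :=
  ⟨Measure.haarMeasure_self (K₀ := (⊤ : TopologicalSpace.PositiveCompacts (OrthGroup n)))⟩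

/-- The action of `O(n)` on the `k`-dimensional subspaces, `L ↦ g L`. -/
def orthAct {n k : ℕ} (g : OrthGroup n) (L : Grass n k) : Grass n k :=
  ⟨L.1.map ((Unitary.linearIsometryEquiv g).toLinearEquiv :
      EuclideanSpace ℝ (Fin n) →ₗ[ℝ] EuclideanSpace ℝ (Fin n)), by
    rw [LinearEquiv.finrank_map_eq]; exact L.2⟩

/-- The span of the first `k` vectors of the standard basis of `ℝⁿ`. -/
def stdGrass {n k : ℕ} (hkn : k ≤ n) : Grass n k :=
  ⟨Submodule.span ℝ (range fun j : Fin k =>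
      EuclideanSpace.basisFun (Fin n) ℝ (Fin.castLE hkn j)), by
    rw [finrank_span_eq_card, Fintype.card_fin]
    exact (EuclideanSpace.basisFun (Fin n) ℝ).orthonormal.linearIndependent.comp _
      (Fin.castLE_injective hkn)⟩

/-- The `O(n)`-invariant probability measure on the `k`-dimensional subspaces of `ℝⁿ`: the law of
`g L₀` for a Haar-distributed `g ∈ O(n)` and a fixed subspace `L₀`. -/
def grassMeasure {n k : ℕ} (hkn : k ≤ n) : Measure (Grass n k) :=
  (orthHaar n).map fun g => orthAct g (stdGrass hkn)

theorem continuous_orthAct {n k : ℕ} (L : Grass n k) :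
    Continuous fun g : OrthGroup n => orthAct g L := by
  refine continuous_induced_rng.2 ?_
  have h : ((fun L : Grass n k => (L.1.starProjection :
      EuclideanSpace ℝ (Fin n) →L[ℝ] EuclideanSpace ℝ (Fin n))) ∘ fun g : OrthGroup n => orthAct g L)
      = fun g : OrthGroup n => (g : EuclideanSpace ℝ (Fin n) →L[ℝ] EuclideanSpace ℝ (Fin n)) *
        L.1.starProjection * ((g⁻¹ : OrthGroup n) :
          EuclideanSpace ℝ (Fin n) →L[ℝ] EuclideanSpace ℝ (Fin n)) := by
    funext g
    ext1 x
    exact Submodule.starProjection_map_apply (Unitary.linearIsometryEquiv g) L.1 x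
  rw [h]
  exact (continuous_subtype_val.mul continuous_const).mul
    (continuous_subtype_val.comp continuous_inv)

instance {n k : ℕ} (hkn : k ≤ n) : IsProbabilityMeasure (grassMeasure hkn) :=
  Measure.isProbabilityMeasure_map (continuous_orthAct _).measurable.aemeasurable

/-- The volume `κ_m` of the unit ball of `ℝᵐ`. -/
def ballVol (m : ℕ) : ℝ :=
  (volume (Metric.closedBall (0 : EuclideanSpace ℝ (Fin m)) 1)).toReal

/-- The constant `κ_n / κ_k` in Kubota's formula. -/
def kubotaConst (n k : ℕ) : ℝ := ballVol n / ballVol k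

end Kubota

end

/-! Everything rests on an induction on the dimension, with Steiner's formula proved along the way.
Adding a segment [-εu, εu], |u| = 1, to a compact convex set L in ℝⁿ⁺¹ raises its volume by exactly
2ε times the volume of the shadow of L along u (`volume_add_symmSegment_lastVec`). For Haar-random
directions, a sum of N such segments of half-length ε/N tends to the ball of radius cε, where c =
`segmentConst n` is the mean of |⟨v, u⟩|; this is the strong law of large numbers for support
functions (`exists_equidistributed`). Hence ρ ↦ vol(K + ρB) has derivative 2/c times the mean shadow
volume of K + ρB. A shadow of K + ρB is a parallel body of a shadow of K, one dimension lower, so by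
induction this derivative is a polynomial in ρ. That is Steiner's formula
(`isSteinerPolynomial_of_shadow`), and comparing coefficients gives Kubota's formula for hyperplanes
(`quermass_succ_eq_integral`). Taking K to be a point identifies the constant, so c is never
computed.

Lower dimensions k follow by iteration: a shadow of a shadow is a single shadow for a product of g
with an element of O(n) ⊂ O(n+1), which right invariance of Haar measure absorbs
(`quermass_eq_integral_shadow`). Shadows in ℝᵏ are isometric to projections onto gℝᵏ, which carries
the formula to the Grassmannian.

For functions, suprema over fibres are attained, so superlevel sets of f|L are projections of
superlevel sets of f (`IsAdmissible.superlevel_projFun`). The formula for sets is applied at each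
level t > 0, and Tonelli exchanges the integrals; this needs joint measurability in (g, t)
(`exists_measurable_quermass_superlevel`). -/

noncomputable section

namespace Kubota

/-- The Euclidean space `ℝⁿ`. -/
abbrev Euc (n : ℕ) : Type := EuclideanSpace ℝ (Fin n)

/-! ### Fibres over the hyperplane of the first coordinates -/

/-- The projection of `ℝⁿ` onto the first `k` coordinates. -/
def coordProj {n k : ℕ} (hkn : k ≤ n) : Euc n →L[ℝ] Euc k :=
  LinearMap.toContinuousLinearMap
    { toFun := fun x => WithLp.toLp 2 fun j => x (Fin.castLE hkn j)
      map_add' := fun _ _ => by ext; simp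
      map_smul' := fun _ _ => by ext; simp }

@[simp]
theorem coordProj_apply {n k : ℕ} (hkn : k ≤ n) (x : Euc n) (j : Fin k) :
    coordProj hkn x j = x (Fin.castLE hkn j) := rfl

/-- The last vector of the standard basis of `ℝⁿ⁺¹`. -/
def lastVec (n : ℕ) : Euc (n + 1) := EuclideanSpace.single (Fin.last n) 1

/-- The point of `ℝⁿ⁺¹` with first coordinates `y` and last coordinate `t`. -/
def fibrePoint {n : ℕ} (y : Euc n) (t : ℝ) : Euc (n + 1) := WithLp.toLp 2 (Fin.snoc y t)

@[simp]
theorem fibrePoint_castSucc {n : ℕ} (y : Euc n) (t : ℝ) (j : Fin n) :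
    fibrePoint y t j.castSucc = y j := by simp [fibrePoint]

@[simp]
theorem fibrePoint_last {n : ℕ} (y : Euc n) (t : ℝ) : fibrePoint y t (Fin.last n) = t := by
  simp [fibrePoint]

@[simp]
theorem lastVec_castSucc {n : ℕ} (j : Fin n) : lastVec n j.castSucc = 0 := by
  simp [lastVec, Fin.castSucc_ne_last]

@[simp]
theorem lastVec_last {n : ℕ} : lastVec n (Fin.last n) = 1 := by
  simp [lastVec]

theorem norm_lastVec (n : ℕ) : ‖lastVec n‖ = 1 := by simp [lastVec]

@[simp]
theorem coordProj_fibrePoint {n : ℕ} (y : Euc n) (t : ℝ) :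
    coordProj n.le_succ (fibrePoint y t) = y := by
  ext j; exact fibrePoint_castSucc y t j

theorem fibrePoint_coordProj {n : ℕ} (x : Euc (n + 1)) :
    fibrePoint (coordProj n.le_succ x) (x (Fin.last n)) = x := by
  ext j
  refine Fin.lastCases ?_ (fun j => ?_) j
  · simp
  · rw [fibrePoint_castSucc]; rfl

theorem fibrePoint_add_smul {n : ℕ} (y : Euc n) (t s : ℝ) :
    fibrePoint y t + s • lastVec n = fibrePoint y (t + s) := by
  ext j
  refine Fin.lastCases ?_ (fun j => ?_) j <;> simp

theorem continuous_fibrePoint {n : ℕ} : Continuous fun p : ℝ × Euc n => fibrePoint p.2 p.1 := by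
  refine (PiLp.continuous_toLp 2 _).comp (continuous_pi fun j => ?_)
  refine Fin.lastCases ?_ (fun j => ?_) j
  · simpa using continuous_fst
  · simp only [Fin.snoc_castSucc]
    exact (PiLp.continuous_apply 2 _ j).comp continuous_snd

theorem measurePreserving_fibrePoint (n : ℕ) :
    MeasurePreserving (fun p : ℝ × Euc n => fibrePoint p.2 p.1) := by
  have h1 : MeasurePreserving (fun p : ℝ × Euc n => (p.1, WithLp.ofLp p.2)) :=
    (MeasurePreserving.id volume).prod (PiLp.volume_preserving_ofLp (Fin n))
  have h2 := (volume_preserving_piFinSuccAbove (fun _ : Fin (n + 1) => ℝ) (Fin.last n)).symm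
  have h3 := (PiLp.volume_preserving_toLp (Fin (n + 1))).comp (h2.comp h1)
  convert h3 using 1
  funext p
  ext j
  refine Fin.lastCases ?_ (fun j => ?_) j
  · simp [MeasurableEquiv.piFinSuccAbove_symm_apply]
  · simp [MeasurableEquiv.piFinSuccAbove_symm_apply]

theorem volume_eq_lintegral_fibre {n : ℕ} {S : Set (Euc (n + 1))} (hS : MeasurableSet S) :
    volume S = ∫⁻ y : Euc n, volume {t : ℝ | fibrePoint y t ∈ S} := by
  rw [← (measurePreserving_fibrePoint n).measure_preimage hS.nullMeasurableSet,
    Measure.volume_eq_prod, Measure.prod_apply_symm (continuous_fibrePoint.measurable hS)]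
  rfl

/-- The segment `[-ε u, ε u]`. -/
def symmSegment {E : Type*} [AddCommGroup E] [Module ℝ E] (ε : ℝ) (u : E) : Set E :=
  (fun t : ℝ => t • u) '' Icc (-ε) ε

section symmSegment

variable {E : Type*} [NormedAddCommGroup E] [NormedSpace ℝ E]

theorem isCompact_symmSegment (ε : ℝ) (u : E) : IsCompact (symmSegment ε u) :=
  isCompact_Icc.image (by fun_prop)

theorem convex_symmSegment (ε : ℝ) (u : E) : Convex ℝ (symmSegment ε u) :=
  (convex_Icc _ _).linear_image (LinearMap.toSpanSingleton ℝ E u)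

theorem zero_mem_symmSegment {ε : ℝ} (hε : 0 ≤ ε) (u : E) : (0 : E) ∈ symmSegment ε u :=
  ⟨0, ⟨by linarith, hε⟩, zero_smul _ _⟩

end symmSegment

/-- Fattening a compact convex set by a segment adds the length of the segment times the volume of
the projection along it. -/
theorem volume_add_symmSegment_lastVec {n : ℕ} {L : Set (Euc (n + 1))} (hL : IsCompact L)
    (hLc : Convex ℝ L) {ε : ℝ} (hε : 0 ≤ ε) :
    volume (L + symmSegment ε (lastVec n)) =
      volume L + ENNReal.ofReal (2 * ε) * volume (coordProj n.le_succ '' L) := by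
  have hPm : MeasurableSet (coordProj n.le_succ '' L) :=
    (hL.image (coordProj n.le_succ).continuous).measurableSet
  rw [volume_eq_lintegral_fibre hL.measurableSet,
    volume_eq_lintegral_fibre (hL.add (isCompact_symmSegment _ _)).measurableSet,
    ← lintegral_indicator_const hPm, ← lintegral_add_right _ (measurable_const.indicator hPm)]
  refine lintegral_congr fun y => ?_
  have hcont : Continuous fun t : ℝ => fibrePoint y t :=
    continuous_fibrePoint.comp (continuous_id.prodMk continuous_const)
  have hmem : ∀ t, fibrePoint y t ∈ L + symmSegment ε (lastVec n) ↔
      ∃ s ∈ Icc (-ε) ε, fibrePoint y (t - s) ∈ L := by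
    intro t
    constructor
    · rintro ⟨x, hx, _, ⟨s, hs, rfl⟩, h⟩
      refine ⟨s, hs, ?_⟩
      have : x = fibrePoint y t + (-s) • lastVec n := by
        rw [← h]; simp
      rw [fibrePoint_add_smul, ← sub_eq_add_neg] at this
      rwa [← this]
    · rintro ⟨s, hs, h⟩
      refine ⟨_, h, _, ⟨s, hs, rfl⟩, ?_⟩
      simp only [fibrePoint_add_smul, sub_add_cancel]
  -- Over a point of the shadow the fibre of L is a nonempty compact interval, lengthened by ε at
  -- both ends. Elsewhere both fibres are empty.
  by_cases hy : y ∈ coordProj n.le_succ '' L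
  · rw [indicator_of_mem hy]
    set T : Set ℝ := {t | fibrePoint y t ∈ L} with hT
    have hTne : T.Nonempty := by
      obtain ⟨x, hx, rfl⟩ := hy
      exact ⟨x (Fin.last n), by rw [hT, mem_ofPred_eq, fibrePoint_coordProj]; exact hx⟩
    have hTconv : Convex ℝ T := by
      intro s hs t ht a b ha hb hab
      have h := hLc hs ht ha hb hab
      have : a • fibrePoint y s + b • fibrePoint y t = fibrePoint y (a • s + b • t) := by
        ext j
        refine Fin.lastCases ?_ (fun j => ?_) j
        · simp
        · simp [← add_mul, hab]
      rwa [this] at h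
    have hTcomp : IsCompact T := by
      refine (hL.image (PiLp.continuous_apply 2 _ (Fin.last n))).of_isClosed_subset
        (hL.isClosed.preimage hcont) ?_
      intro t ht
      exact ⟨_, ht, fibrePoint_last y t⟩
    have hI := eq_Icc_of_connected_compact (hTconv.isConnected hTne) hTcomp
    have hle : sInf T ≤ sSup T := by
      rw [← nonempty_Icc, ← hI]; exact hTne
    have hS : {t : ℝ | fibrePoint y t ∈ L + symmSegment ε (lastVec n)}
        = Icc (sInf T - ε) (sSup T + ε) := by
      ext t
      rw [mem_ofPred_eq, hmem]
      have : ∀ s, fibrePoint y (t - s) ∈ L ↔ t - s ∈ Icc (sInf T) (sSup T) := by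
        intro s; rw [← hI, hT, mem_ofPred_eq]
      simp only [this, mem_Icc]
      constructor
      · rintro ⟨s, ⟨h1, h2⟩, h3, h4⟩
        constructor <;> linarith
      · rintro ⟨h1, h2⟩
        -- The shift is the signed excess of t past the nearer endpoint of the fibre, or 0 inside
        -- it.
        by_cases h3 : t < sInf T
        · exact ⟨t - sInf T, ⟨by linarith, by linarith⟩, by linarith, by linarith⟩
        · by_cases h4 : sSup T < t
          · exact ⟨t - sSup T, ⟨by linarith, by linarith⟩, by linarith, by linarith⟩
          · exact ⟨0, ⟨by linarith, hε⟩, by linarith, by linarith⟩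
    rw [hS, hI, Real.volume_Icc, Real.volume_Icc, ← hI, ← ENNReal.ofReal_add (by linarith)
      (by linarith)]
    congr 1; ring
  · rw [indicator_of_notMem hy, add_zero]
    have h0 : ∀ t, fibrePoint y t ∉ L := fun t ht => hy ⟨_, ht, coordProj_fibrePoint y t⟩
    congr 1
    ext t
    rw [mem_ofPred_eq, hmem, mem_ofPred_eq]
    simp [h0]

/-! ### Random shadows and zonotopes -/

/-- The composition of the inverse of `g ∈ O(n)` with the projection onto the first `k`
coordinates. -/
def shadowMap {n k : ℕ} (hkn : k ≤ n) (g : OrthGroup n) : Euc n →L[ℝ] Euc k :=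
  coordProj hkn ∘L ((g⁻¹ : OrthGroup n) : Euc n →L[ℝ] Euc n)

theorem orthGroup_apply_inv_apply {n : ℕ} (g : OrthGroup n) (x : Euc n) :
    (g : Euc n →L[ℝ] Euc n) (((g⁻¹ : OrthGroup n) : Euc n →L[ℝ] Euc n) x) = x :=
  congr($(mul_inv_cancel g).val x)

theorem orthGroup_inv_apply_apply {n : ℕ} (g : OrthGroup n) (x : Euc n) :
    ((g⁻¹ : OrthGroup n) : Euc n →L[ℝ] Euc n) ((g : Euc n →L[ℝ] Euc n) x) = x :=
  congr($(inv_mul_cancel g).val x)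

theorem volume_orthGroup_image {n : ℕ} (g : OrthGroup n) (S : Set (Euc n)) :
    volume ((g : Euc n →L[ℝ] Euc n) '' S) = volume S := by
  have h := (Unitary.linearIsometryEquiv g).symm.measurePreserving
  have h2 := h.measure_preimage_equiv (f := (Unitary.linearIsometryEquiv g).symm.toMeasurableEquiv) S
  rw [← h2]
  congr 1
  exact (Unitary.linearIsometryEquiv g).toEquiv.image_eq_preimage_symm S

/-- Rotating by g⁻¹ preserves volume and turns the segment to the last coordinate direction. -/
theorem volume_add_symmSegment {n : ℕ} {L : Set (Euc (n + 1))} (hL : IsCompact L)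
    (hLc : Convex ℝ L) {ε : ℝ} (hε : 0 ≤ ε) (g : OrthGroup (n + 1)) :
    volume (L + symmSegment ε ((g : Euc (n + 1) →L[ℝ] Euc (n + 1)) (lastVec n))) =
      volume L + ENNReal.ofReal (2 * ε) * volume (shadowMap n.le_succ g '' L) := by
  set G : Euc (n + 1) →L[ℝ] Euc (n + 1) := ((g⁻¹ : OrthGroup (n + 1)) : Euc (n + 1) →L[ℝ] Euc (n + 1))
    with hG
  have h := volume_add_symmSegment_lastVec (hL.image G.continuous)
    (hLc.linear_image G.toLinearMap) hε
  rw [← volume_orthGroup_image g⁻¹, ← volume_orthGroup_image g⁻¹ L]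
  convert h using 3
  · rw [← hG, image_add]
    congr 1
    rw [symmSegment, symmSegment, image_image]
    refine image_congr fun t _ => ?_
    rw [map_smul, hG, orthGroup_inv_apply_apply]
  · exact congrArg _ (image_comp (coordProj n.le_succ) G L)

/-! ### Zonotopes and their support functions. -/

section zonotope

variable {E : Type*} [NormedAddCommGroup E]

/-- The zonotope `∑_{j < N} [-ε u_j, ε u_j]`. -/
def zonotope [NormedSpace ℝ E] (ε : ℝ) (u : ℕ → E) (N : ℕ) : Set E :=
  ∑ j ∈ Finset.range N, symmSegment ε (u j)

section NormedSpace

variable [NormedSpace ℝ E]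

@[simp]
theorem zonotope_zero (ε : ℝ) (u : ℕ → E) : zonotope ε u 0 = 0 := by simp [zonotope]

theorem zonotope_succ (ε : ℝ) (u : ℕ → E) (N : ℕ) :
    zonotope ε u (N + 1) = zonotope ε u N + symmSegment ε (u N) := by
  simp [zonotope, Finset.sum_range_succ]

theorem isCompact_zonotope (ε : ℝ) (u : ℕ → E) (N : ℕ) : IsCompact (zonotope ε u N) := by
  induction N with
  | zero => simp
  | succ N ih => rw [zonotope_succ]; exact ih.add (isCompact_symmSegment _ _)

theorem convex_zonotope (ε : ℝ) (u : ℕ → E) (N : ℕ) : Convex ℝ (zonotope ε u N) := by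
  induction N with
  | zero => simpa using convex_zero
  | succ N ih => rw [zonotope_succ]; exact ih.add (convex_symmSegment _ _)

theorem zonotope_subset_succ {ε : ℝ} (hε : 0 ≤ ε) (u : ℕ → E) (N : ℕ) :
    zonotope ε u N ⊆ zonotope ε u (N + 1) := by
  intro x hx
  rw [zonotope_succ]
  exact ⟨x, hx, 0, zero_mem_symmSegment hε _, add_zero x⟩

theorem zero_mem_zonotope {ε : ℝ} (hε : 0 ≤ ε) (u : ℕ → E) (N : ℕ) :
    (0 : E) ∈ zonotope ε u N := by
  induction N with
  | zero => simp
  | succ N ih => exact zonotope_subset_succ hε u N ih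

end NormedSpace

variable [InnerProductSpace ℝ E]

/-- Together with `exists_mem_zonotope_inner_eq`, this identifies the support function of the
zonotope as w ↦ ε ∑ |⟨w, u_j⟩|. -/
theorem inner_le_of_mem_zonotope {ε : ℝ} {u : ℕ → E} {N : ℕ} {z : E} (hz : z ∈ zonotope ε u N)
    (w : E) : inner ℝ w z ≤ ε * ∑ j ∈ Finset.range N, |inner ℝ w (u j)| := by
  induction N generalizing z with
  | zero =>
    simp only [zonotope_zero, Set.mem_zero] at hz
    simp [hz]
  | succ N ih =>
    rw [zonotope_succ] at hz
    obtain ⟨x, hx, _, ⟨t, ht, rfl⟩, rfl⟩ := hz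
    rw [inner_add_right, Finset.sum_range_succ, mul_add]
    refine add_le_add (ih hx) ?_
    simp only [inner_smul_right]
    calc t * inner ℝ w (u N) ≤ |t * inner ℝ w (u N)| := le_abs_self _
      _ = |t| * |inner ℝ w (u N)| := abs_mul _ _
      _ ≤ ε * |inner ℝ w (u N)| := by gcongr; exact abs_le.2 ht

theorem exists_mem_zonotope_inner_eq {ε : ℝ} (hε : 0 ≤ ε) (u : ℕ → E) (N : ℕ) (w : E) :
    ∃ z ∈ zonotope ε u N, inner ℝ w z = ε * ∑ j ∈ Finset.range N, |inner ℝ w (u j)| := by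
  induction N with
  | zero => exact ⟨0, by simp, by simp⟩
  | succ N ih =>
    obtain ⟨z, hz, h⟩ := ih
    rw [zonotope_succ, Finset.sum_range_succ, mul_add, ← h]
    rcases le_total 0 (inner ℝ w (u N)) with h0 | h0
    · refine ⟨_, add_mem_add hz ⟨ε, ⟨by linarith, le_rfl⟩, rfl⟩, ?_⟩
      rw [inner_add_right, inner_smul_right, abs_of_nonneg h0]
    · refine ⟨_, add_mem_add hz ⟨-ε, ⟨le_rfl, by linarith⟩, rfl⟩, ?_⟩
      rw [inner_add_right, inner_smul_right, abs_of_nonpos h0]; ring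

/-- The support function bound is tested at w = z itself. -/
theorem zonotope_subset_closedBall {ε r : ℝ} (hr : 0 ≤ r) {u : ℕ → E} {N : ℕ}
    (h : ∀ w, ε * ∑ j ∈ Finset.range N, |inner ℝ w (u j)| ≤ r * ‖w‖) :
    zonotope ε u N ⊆ Metric.closedBall 0 r := by
  intro z hz
  rw [mem_closedBall_zero_iff]
  have h1 := (inner_le_of_mem_zonotope hz z).trans (h z)
  rw [real_inner_self_eq_norm_sq, sq] at h1
  rcases eq_or_ne ‖z‖ 0 with h0 | h0
  · rw [h0]; exact hr
  · exact le_of_mul_le_mul_right h1 (lt_of_le_of_ne (norm_nonneg _) h0.symm)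

/-- A point of the ball outside the zonotope would be strictly separated from it by some w,
contradicting the comparison of support functions. -/
theorem closedBall_subset_zonotope [CompleteSpace E] {ε r : ℝ} (hε : 0 ≤ ε) {u : ℕ → E} {N : ℕ}
    (h : ∀ w, r * ‖w‖ ≤ ε * ∑ j ∈ Finset.range N, |inner ℝ w (u j)|) :
    Metric.closedBall 0 r ⊆ zonotope ε u N := by
  intro x hx
  rw [mem_closedBall_zero_iff] at hx
  by_contra hxz
  obtain ⟨f, a, hf, ha⟩ := geometric_hahn_banach_closed_point (convex_zonotope ε u N)
    (isCompact_zonotope ε u N).isClosed hxz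
  set w := (InnerProductSpace.toDual ℝ E).symm f with hw
  have hfw : ∀ y, f y = inner ℝ w y := fun y => by
    rw [hw, InnerProductSpace.toDual_symm_apply]
  obtain ⟨z, hz, hz'⟩ := exists_mem_zonotope_inner_eq hε u N w
  have h1 := hf z hz
  rw [hfw, hz'] at h1
  rw [hfw] at ha
  have h2 := real_inner_le_norm w x
  have h3 := h w
  have h4 : ‖w‖ * ‖x‖ ≤ r * ‖w‖ := by
    rw [mul_comm]; gcongr
  linarith

end zonotope

/-- The segments are added one at a time; the shadow of each partial sum contains that of L. -/
theorem volume_add_zonotope_ge {n : ℕ} {L : Set (Euc (n + 1))} (hL : IsCompact L)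
    (hLc : Convex ℝ L) {ε : ℝ} (hε : 0 ≤ ε) (g : ℕ → OrthGroup (n + 1)) (N : ℕ) :
    volume L + ENNReal.ofReal (2 * ε) *
        ∑ j ∈ Finset.range N, volume (shadowMap n.le_succ (g j) '' L) ≤
      volume (L + zonotope ε (fun j => (g j : Euc (n + 1) →L[ℝ] Euc (n + 1)) (lastVec n)) N) := by
  induction N with
  | zero => simp
  | succ N ih =>
    rw [zonotope_succ, ← add_assoc, volume_add_symmSegment (hL.add (isCompact_zonotope _ _ _))
      (hLc.add (convex_zonotope _ _ _)) hε, Finset.sum_range_succ, mul_add, ← add_assoc]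
    gcongr
    intro x hx
    exact ⟨x, hx, 0, zero_mem_zonotope hε _ _, add_zero x⟩

/-- Here M contains every partial sum, so its shadows bound all the increments from above. -/
theorem volume_add_zonotope_le {n : ℕ} {L M : Set (Euc (n + 1))} (hL : IsCompact L)
    (hLc : Convex ℝ L) {ε : ℝ} (hε : 0 ≤ ε) (g : ℕ → OrthGroup (n + 1)) (N : ℕ)
    (hM : L + zonotope ε (fun j => (g j : Euc (n + 1) →L[ℝ] Euc (n + 1)) (lastVec n)) N ⊆ M) :
    volume (L + zonotope ε (fun j => (g j : Euc (n + 1) →L[ℝ] Euc (n + 1)) (lastVec n)) N) ≤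
      volume L + ENNReal.ofReal (2 * ε) *
        ∑ j ∈ Finset.range N, volume (shadowMap n.le_succ (g j) '' M) := by
  induction N with
  | zero => simp
  | succ N ih =>
    have hM' := (add_subset_add_left (zonotope_subset_succ hε _ N)).trans hM
    rw [zonotope_succ, ← add_assoc, volume_add_symmSegment (hL.add (isCompact_zonotope _ _ _))
      (hLc.add (convex_zonotope _ _ _)) hε, Finset.sum_range_succ, mul_add, ← add_assoc]
    gcongr
    exact ih hM'

/-! ### The orthogonal group -/

instance (n : ℕ) : (orthHaar n).IsHaarMeasure :=
  inferInstanceAs (Measure.haarMeasure ⊤).IsHaarMeasure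

/-- Conjugation by g⁻¹ is a surjective continuous endomorphism, so it preserves the Haar probability
measure; composed with left multiplication by g it is right multiplication by g. -/
instance (n : ℕ) : (orthHaar n).IsMulRightInvariant := by
  refine ⟨fun g => ?_⟩
  have h := MonoidHom.measurePreserving (μ := orthHaar n) (ν := orthHaar n)
    (f := (MulAut.conj g⁻¹).toMonoidHom)
    (by
      show Continuous fun x => g⁻¹ * x * (g⁻¹)⁻¹
      fun_prop)
    (MulAut.conj g⁻¹).surjective (by simp)
  have h2 := (h.comp (measurePreserving_mul_left (orthHaar n) g)).map_eq
  convert h2 using 2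
  funext x
  simp

theorem continuous_shadowMap_apply {n k : ℕ} (hkn : k ≤ n) :
    Continuous fun p : OrthGroup n × Euc n => shadowMap hkn p.1 p.2 := by
  refine (coordProj hkn).continuous.comp ?_
  exact (continuous_subtype_val.comp (continuous_inv.comp continuous_fst)).clm_apply continuous_snd

theorem exists_orthGroup_apply_eq {n : ℕ} {v w : Euc n} (h : ‖v‖ = ‖w‖) :
    ∃ g : OrthGroup n, (g : Euc n →L[ℝ] Euc n) v = w := by
  refine ⟨Unitary.linearIsometryEquiv.symm (Submodule.reflection (ℝ ∙ (v - w))ᗮ), ?_⟩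
  exact Submodule.reflection_sub h

/-! ### Coordinate projections -/

/-- The inclusion `ℝᵏ → ℝⁿ` into the first coordinates, adjoint to the projection. -/
def coordIncl {n k : ℕ} (hkn : k ≤ n) : Euc k →L[ℝ] Euc n :=
  ContinuousLinearMap.adjoint (coordProj hkn)

theorem inner_coordIncl {n k : ℕ} (hkn : k ≤ n) (y : Euc k) (x : Euc n) :
    inner ℝ (coordIncl hkn y) x = inner ℝ y (coordProj hkn x) :=
  ContinuousLinearMap.adjoint_inner_left _ _ _

@[simp]
theorem coordProj_coordIncl {n k : ℕ} (hkn : k ≤ n) (y : Euc k) :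
    coordProj hkn (coordIncl hkn y) = y := by
  ext j
  have h1 : coordProj hkn (EuclideanSpace.single (Fin.castLE hkn j) (1 : ℝ)) =
      EuclideanSpace.single j 1 := by
    ext i; simp
  have h2 := inner_coordIncl hkn y (EuclideanSpace.single (Fin.castLE hkn j) (1 : ℝ))
  rw [h1] at h2
  simpa [EuclideanSpace.inner_single_right] using h2

theorem norm_coordIncl {n k : ℕ} (hkn : k ≤ n) (y : Euc k) : ‖coordIncl hkn y‖ = ‖y‖ := by
  have h := inner_coordIncl hkn y (coordIncl hkn y)
  rw [coordProj_coordIncl, real_inner_self_eq_norm_sq, real_inner_self_eq_norm_sq] at h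
  exact (sq_eq_sq₀ (norm_nonneg _) (norm_nonneg _)).1 h

theorem norm_coordProj_le {n k : ℕ} (hkn : k ≤ n) (x : Euc n) : ‖coordProj hkn x‖ ≤ ‖x‖ := by
  have h := inner_coordIncl hkn (coordProj hkn x) x
  rw [real_inner_self_eq_norm_sq] at h
  have h2 := real_inner_le_norm (coordIncl hkn (coordProj hkn x)) x
  rw [norm_coordIncl, h, sq] at h2
  rcases eq_or_ne ‖coordProj hkn x‖ 0 with h0 | h0
  · rw [h0]; exact norm_nonneg _
  · exact le_of_mul_le_mul_left h2 (lt_of_le_of_ne (norm_nonneg _) h0.symm)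

theorem orthGroup_norm_apply {n : ℕ} (g : OrthGroup n) (x : Euc n) :
    ‖(g : Euc n →L[ℝ] Euc n) x‖ = ‖x‖ := Unitary.norm_map g x

theorem norm_shadowMap_le {n k : ℕ} (hkn : k ≤ n) (g : OrthGroup n) (x : Euc n) :
    ‖shadowMap hkn g x‖ ≤ ‖x‖ :=
  (norm_coordProj_le hkn _).trans (orthGroup_norm_apply _ _).le

theorem shadowMap_image_closedBall {n k : ℕ} (hkn : k ≤ n) (g : OrthGroup n) (r : ℝ) :
    shadowMap hkn g '' Metric.closedBall 0 r = Metric.closedBall 0 r := by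
  apply Subset.antisymm
  · rintro _ ⟨x, hx, rfl⟩
    rw [mem_closedBall_zero_iff] at hx ⊢
    exact (norm_shadowMap_le hkn g x).trans hx
  · intro y hy
    refine ⟨(g : Euc n →L[ℝ] Euc n) (coordIncl hkn y), ?_, ?_⟩
    · rw [mem_closedBall_zero_iff] at hy ⊢
      rwa [orthGroup_norm_apply, norm_coordIncl]
    · exact (congrArg _ (orthGroup_inv_apply_apply g _)).trans (coordProj_coordIncl hkn y)

theorem shadowMap_image_add_closedBall {n k : ℕ} (hkn : k ≤ n) (g : OrthGroup n) (K : Set (Euc n))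
    (r : ℝ) : shadowMap hkn g '' (K + Metric.closedBall 0 r) =
      shadowMap hkn g '' K + Metric.closedBall 0 r := by
  rw [image_add, shadowMap_image_closedBall]

/-! ### Measurability of the volume of a shadow -/

/-- The shadows are the sections of one compact subset of O(n) × ℝᵏ. -/
theorem measurable_volume_shadowMap_image {n k : ℕ} (hkn : k ≤ n) {K : Set (Euc n)}
    (hK : IsCompact K) : Measurable fun g : OrthGroup n => volume (shadowMap hkn g '' K) := by
  have hcont : Continuous fun p : OrthGroup n × Euc n => (p.1, shadowMap hkn p.1 p.2) :=
    continuous_fst.prodMk (continuous_shadowMap_apply hkn)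
  have hc := ((isCompact_univ (X := OrthGroup n)).prod hK).image hcont
  convert measurable_measure_prodMk_left (ν := (volume : Measure (Euc k))) hc.measurableSet using 3
    with g
  ext y
  simp only [mem_image, mem_preimage, Prod.exists, mem_prod, mem_univ, true_and, Prod.mk.injEq]
  constructor
  · rintro ⟨x, hx, rfl⟩; exact ⟨g, x, hx, rfl, rfl⟩
  · rintro ⟨_, x, hx, rfl, rfl⟩; exact ⟨x, hx, rfl⟩

theorem shadowMap_image_isCompact {n k : ℕ} (hkn : k ≤ n) (g : OrthGroup n) {K : Set (Euc n)}
    (hK : IsCompact K) : IsCompact (shadowMap hkn g '' K) :=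
  hK.image (shadowMap hkn g).continuous

theorem exists_volume_shadowMap_image_le {n k : ℕ} (hkn : k ≤ n) {K : Set (Euc n)}
    (hK : IsCompact K) : ∃ C : ℝ, ∀ g : OrthGroup n,
      (volume (shadowMap hkn g '' K)).toReal ≤ C := by
  obtain ⟨R, hR⟩ := hK.isBounded.subset_closedBall 0
  refine ⟨(volume (Metric.closedBall (0 : Euc k) R)).toReal, fun g => ?_⟩
  refine ENNReal.toReal_mono measure_closedBall_lt_top.ne (measure_mono ?_)
  rw [← shadowMap_image_closedBall hkn g]
  exact image_mono hR

theorem integrable_volume_shadowMap_image {n k : ℕ} (hkn : k ≤ n) {K : Set (Euc n)}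
    (hK : IsCompact K) :
    Integrable (fun g : OrthGroup n => (volume (shadowMap hkn g '' K)).toReal) (orthHaar n) := by
  obtain ⟨C, hC⟩ := exists_volume_shadowMap_image_le hkn hK
  refine Integrable.of_bound
    (measurable_volume_shadowMap_image hkn hK).ennreal_toReal.aestronglyMeasurable C ?_
  refine Eventually.of_forall fun g => ?_
  rw [Real.norm_of_nonneg ENNReal.toReal_nonneg]
  exact hC g

/-! ### Zonotopes approximating the ball -/

/-- The strong law on the product space of sequences. Banach-valued F are allowed so that it applies
in a space of continuous functions, where convergence is uniform. -/
theorem ae_tendsto_average {G B : Type*} [MeasurableSpace G] (μ : Measure G)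
    [IsProbabilityMeasure μ] [NormedAddCommGroup B] [NormedSpace ℝ B] [CompleteSpace B]
    [MeasurableSpace B] [BorelSpace B] {F : G → B} (hF : Measurable F) (hint : Integrable F μ) :
    ∀ᵐ ω ∂(Measure.infinitePi fun _ : ℕ => μ),
      Tendsto (fun N : ℕ => (N : ℝ)⁻¹ • ∑ j ∈ Finset.range N, F (ω j)) atTop (𝓝 (∫ g, F g ∂μ)) := by
  have hmp : ∀ i, MeasurePreserving (Function.eval i) (Measure.infinitePi fun _ : ℕ => μ) μ :=
    fun i => measurePreserving_eval_infinitePi _ i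
  have hind := ProbabilityTheory.iIndepFun_infinitePi (P := fun _ : ℕ => μ) (X := fun _ => F)
    fun _ => hF
  have h := ProbabilityTheory.strong_law_ae (μ := Measure.infinitePi fun _ : ℕ => μ)
    (fun i ω => F (ω i)) ((hmp 0).integrable_comp_of_integrable hint)
    (fun i j hij => hind.indepFun hij)
    (fun i => ⟨(hF.comp (measurable_pi_apply i)).aemeasurable,
      (hF.comp (measurable_pi_apply 0)).aemeasurable, by
        have h := fun j => Measure.map_map (μ := Measure.infinitePi fun _ : ℕ => μ) hF
          (hmp j).measurable
        exact (h i).symm.trans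
          ((congrArg _ ((hmp i).map_eq.trans (hmp 0).map_eq.symm)).trans (h 0))⟩)
  have he : ∫ ω, F (ω 0) ∂(Measure.infinitePi fun _ : ℕ => μ) = ∫ g, F g ∂μ := by
    have h0 := hint.aestronglyMeasurable
    rw [← (hmp 0).map_eq] at h0
    conv_rhs => rw [← (hmp 0).map_eq]
    exact (integral_map (hmp 0).measurable.aemeasurable h0).symm
  simpa only [he] using h

/-- The mean of `|⟨v, u⟩|` over the unit sphere of `ℝⁿ⁺¹`, for a unit vector `v`. -/
def segmentConst (n : ℕ) : ℝ :=
  ∫ g : OrthGroup (n + 1),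
    |inner ℝ (lastVec n) ((g : Euc (n + 1) →L[ℝ] Euc (n + 1)) (lastVec n))| ∂(orthHaar (n + 1))

theorem continuous_abs_inner_lastVec {n : ℕ} :
    Continuous fun p : OrthGroup (n + 1) × Euc (n + 1) =>
      |inner ℝ p.2 ((p.1 : Euc (n + 1) →L[ℝ] Euc (n + 1)) (lastVec n))| := by
  refine continuous_abs.comp (continuous_snd.inner ?_)
  exact (continuous_subtype_val.comp continuous_fst).clm_apply continuous_const

theorem integrable_of_continuous_orthGroup {n : ℕ} {B : Type*} [NormedAddCommGroup B]
    {F : OrthGroup n → B} (hF : Continuous F) : Integrable F (orthHaar n) :=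
  hF.integrable_of_hasCompactSupport (HasCompactSupport.of_compactSpace F)

/-- O(n+1) is transitive on spheres, so w is a rotation of ‖w‖ times the last basis vector; left
invariance removes the rotation. -/
theorem integral_abs_inner_lastVec {n : ℕ} (w : Euc (n + 1)) :
    ∫ g : OrthGroup (n + 1), |inner ℝ w ((g : Euc (n + 1) →L[ℝ] Euc (n + 1)) (lastVec n))|
      ∂(orthHaar (n + 1)) = segmentConst n * ‖w‖ := by
  obtain ⟨h, hh⟩ := exists_orthGroup_apply_eq (v := ‖w‖ • lastVec n) (w := w)
    (by rw [norm_smul, norm_lastVec]; simp)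
  rw [← integral_mul_left_eq_self _ h, segmentConst, ← integral_mul_const]
  congr 1
  funext g
  conv_lhs => rw [← hh]
  have : ((h * g : OrthGroup (n + 1)) : Euc (n + 1) →L[ℝ] Euc (n + 1)) (lastVec n) =
    (h : Euc (n + 1) →L[ℝ] Euc (n + 1)) ((g : Euc (n + 1) →L[ℝ] Euc (n + 1)) (lastVec n)) := rfl
  rw [this, Unitary.inner_map_map, inner_smul_left, abs_mul, mul_comm]
  simp

/-- A unit vector satisfies ∑ |u_i| ≥ ∑ u_i² = 1; averaging over rotations gives (n+1) ·
`segmentConst n` ≥ 1. -/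
theorem segmentConst_pos (n : ℕ) : 0 < segmentConst n := by
  have h1 : ∀ u : Euc (n + 1), ‖u‖ = 1 →
      1 ≤ ∑ i, |inner ℝ (EuclideanSpace.single i (1 : ℝ)) u| := by
    intro u hu
    have h2 := EuclideanSpace.norm_sq_eq u
    rw [hu, one_pow] at h2
    refine h2.le.trans (Finset.sum_le_sum fun i _ => ?_)
    have h3 : ‖u i‖ ≤ 1 := hu ▸ PiLp.norm_apply_le u i
    have h4 : inner ℝ (EuclideanSpace.single i (1 : ℝ)) u = u i := by
      simp [EuclideanSpace.inner_single_left]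
    rw [h4, ← Real.norm_eq_abs]
    nlinarith [norm_nonneg (u i)]
  have hcont : ∀ w : Euc (n + 1), Continuous fun g : OrthGroup (n + 1) =>
      |inner ℝ w ((g : Euc (n + 1) →L[ℝ] Euc (n + 1)) (lastVec n))| := fun w =>
    continuous_abs_inner_lastVec.comp (continuous_id.prodMk continuous_const)
  have h5 : (1 : ℝ) ≤ ∑ i : Fin (n + 1), segmentConst n := by
    calc (1 : ℝ) = ∫ _ : OrthGroup (n + 1), (1 : ℝ) ∂(orthHaar (n + 1)) := by simp
      _ ≤ ∫ g : OrthGroup (n + 1), ∑ i, |inner ℝ (EuclideanSpace.single i (1 : ℝ))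
            ((g : Euc (n + 1) →L[ℝ] Euc (n + 1)) (lastVec n))| ∂(orthHaar (n + 1)) := by
          refine integral_mono (integrable_const _)
            (integrable_finsetSum _ fun i _ => integrable_of_continuous_orthGroup (hcont _)) ?_
          intro g
          exact h1 _ (by rw [orthGroup_norm_apply, norm_lastVec])
      _ = ∑ i : Fin (n + 1), segmentConst n := by
          rw [integral_finsetSum _ fun i _ => integrable_of_continuous_orthGroup (hcont _)]
          refine Finset.sum_congr rfl fun i _ => ?_
          rw [integral_abs_inner_lastVec]; simp
  rw [Finset.sum_const] at h5
  by_contra hneg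
  have : (Finset.univ : Finset (Fin (n + 1))).card • segmentConst n ≤ 0 :=
    smul_nonpos_of_nonneg_of_nonpos (Nat.zero_le _) (not_lt.1 hneg)
  linarith

/-- A sequence of rotations along which the averages of `φ` converge and the averaged support
functions of the rotated segments converge uniformly to that of a ball. -/
theorem exists_equidistributed {n : ℕ} {φ : OrthGroup (n + 1) → ℝ} (hφ : Measurable φ)
    (hint : Integrable φ (orthHaar (n + 1))) :
    ∃ g : ℕ → OrthGroup (n + 1),
      Tendsto (fun N : ℕ => (N : ℝ)⁻¹ * ∑ j ∈ Finset.range N, φ (g j)) atTop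
        (𝓝 (∫ x, φ x ∂(orthHaar (n + 1)))) ∧
      ∀ δ > 0, ∀ᶠ N : ℕ in atTop, ∀ w : Euc (n + 1),
        |(N : ℝ)⁻¹ * ∑ j ∈ Finset.range N,
          |inner ℝ w ((g j : Euc (n + 1) →L[ℝ] Euc (n + 1)) (lastVec n))| -
            segmentConst n * ‖w‖| ≤ δ * ‖w‖ := by
  let S := Metric.sphere (0 : Euc (n + 1)) 1
  let _ : MeasurableSpace C(S, ℝ) := borel _
  have : BorelSpace C(S, ℝ) := ⟨rfl⟩
  let Fc : C(OrthGroup (n + 1) × S, ℝ) :=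
    ⟨fun p => |inner ℝ (p.2 : Euc (n + 1))
      ((p.1 : Euc (n + 1) →L[ℝ] Euc (n + 1)) (lastVec n))|,
      continuous_abs_inner_lastVec.comp
        (continuous_fst.prodMk (continuous_subtype_val.comp continuous_snd))⟩
  let F : C(OrthGroup (n + 1), C(S, ℝ)) := Fc.curry
  have hFint : Integrable F (orthHaar (n + 1)) := integrable_of_continuous_orthGroup F.continuous
  -- Both laws hold almost surely, so one sequence serves for both; the second is in C(S, ℝ), which
  -- makes the convergence uniform over unit vectors.
  obtain ⟨g, hg1, hg2⟩ := ((ae_tendsto_average (orthHaar (n + 1)) hφ hint).and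
    (ae_tendsto_average (orthHaar (n + 1)) F.continuous.measurable hFint)).exists
  refine ⟨g, hg1, fun δ hδ => ?_⟩
  filter_upwards [Metric.tendsto_nhds.1 hg2 δ hδ] with N hN w
  rcases eq_or_ne w 0 with rfl | hw
  · simp
  have hw' : 0 < ‖w‖ := norm_pos_iff.2 hw
  -- Both sides are homogeneous in w, so the unit sphere suffices.
  let s : S := ⟨‖w‖⁻¹ • w, by simp [S, norm_smul, hw]⟩
  have hs : w = ‖w‖ • (s : Euc (n + 1)) := by
    simp [s, smul_smul, hw]
  have hcong := (ContinuousMap.dist_apply_le_dist s).trans hN.le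
  have hI : (∫ x, F x ∂(orthHaar (n + 1))) s = segmentConst n := by
    have := ContinuousLinearMap.integral_comp_comm
      (ContinuousMap.evalCLM ℝ s : C(S, ℝ) →L[ℝ] ℝ) hFint
    simp only [ContinuousMap.evalCLM_apply] at this
    rw [← this]
    refine (integral_abs_inner_lastVec (s : Euc (n + 1))).trans ?_
    rw [norm_eq_of_mem_sphere, mul_one]
  rw [hI, Real.dist_eq] at hcong
  have hsum : ((N : ℝ)⁻¹ • ∑ j ∈ Finset.range N, F (g j)) s =
      (N : ℝ)⁻¹ * ∑ j ∈ Finset.range N, |inner ℝ (s : Euc (n + 1))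
        ((g j : Euc (n + 1) →L[ℝ] Euc (n + 1)) (lastVec n))| := by
    simp [F, Fc]
  rw [hsum] at hcong
  have hterm : ∀ j, |inner ℝ w ((g j : Euc (n + 1) →L[ℝ] Euc (n + 1)) (lastVec n))| =
      ‖w‖ * |inner ℝ (s : Euc (n + 1))
        ((g j : Euc (n + 1) →L[ℝ] Euc (n + 1)) (lastVec n))| := by
    intro j
    conv_lhs => rw [hs]
    rw [inner_smul_left, abs_mul]; simp
  simp only [hterm, ← Finset.mul_sum]
  calc _ = |‖w‖ * ((N : ℝ)⁻¹ * ∑ j ∈ Finset.range N, |inner ℝ (s : Euc (n + 1))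
        ((g j : Euc (n + 1) →L[ℝ] Euc (n + 1)) (lastVec n))| - segmentConst n)| := by
        congr 1; ring
    _ ≤ δ * ‖w‖ := by
        rw [abs_mul, abs_norm, mul_comm]; gcongr

/-! ### The volume of parallel bodies and its increments -/

theorem measureReal_add_closedBall_ge {n : ℕ} {L : Set (Euc (n + 1))} (hL : IsCompact L)
    (hLc : Convex ℝ L) {ε : ℝ} (hε : 0 ≤ ε) :
    (volume L).toReal + 2 * ε * ∫ g : OrthGroup (n + 1),
        (volume (shadowMap n.le_succ g '' L)).toReal ∂(orthHaar (n + 1)) ≤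
      (volume (L + Metric.closedBall 0 (segmentConst n * ε))).toReal := by
  obtain ⟨g, hg1, hg2⟩ := exists_equidistributed
    (measurable_volume_shadowMap_image n.le_succ hL).ennreal_toReal
    (integrable_volume_shadowMap_image n.le_succ hL)
  have hc := segmentConst_pos n
  set Φ := ∫ g : OrthGroup (n + 1), (volume (shadowMap n.le_succ g '' L)).toReal
    ∂(orthHaar (n + 1))
  -- Shrinking the segments by 1 + δ absorbs the relative error in the support function, so that the
  -- zonotope fits inside the ball.
  have key : ∀ δ > 0, (volume L).toReal + 2 * (ε / (1 + δ)) * Φ ≤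
      (volume (L + Metric.closedBall 0 (segmentConst n * ε))).toReal := by
    intro δ hδ
    refine le_of_tendsto ((hg1.const_mul (2 * (ε / (1 + δ)))).const_add (volume L).toReal) ?_
    filter_upwards [hg2 (segmentConst n * δ) (by positivity)] with N hN
    have hη : 0 ≤ ε / (1 + δ) * (N : ℝ)⁻¹ := by positivity
    have hsub : zonotope (ε / (1 + δ) * (N : ℝ)⁻¹)
        (fun j => (g j : Euc (n + 1) →L[ℝ] Euc (n + 1)) (lastVec n)) N ⊆
        Metric.closedBall 0 (segmentConst n * ε) := by
      refine zonotope_subset_closedBall (by positivity) fun w => ?_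
      have h1 := (abs_le.1 (hN w)).2
      rw [mul_assoc]
      calc _ ≤ ε / (1 + δ) * (segmentConst n * δ * ‖w‖ + segmentConst n * ‖w‖) := by
            gcongr; linarith
        _ = segmentConst n * ε * ‖w‖ := by field_simp; ring
    have h2 := (volume_add_zonotope_ge hL hLc hη g N).trans
      (measure_mono (add_subset_add_left hsub))
    have h3 := ENNReal.toReal_mono (hL.add (isCompact_closedBall _ _)).measure_lt_top.ne h2
    have hfin : ∀ j ∈ Finset.range N, volume (shadowMap n.le_succ (g j) '' L) ≠ ⊤ := fun j _ =>
      (shadowMap_image_isCompact n.le_succ _ hL).measure_lt_top.ne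
    rw [ENNReal.toReal_add hL.measure_lt_top.ne
      (ENNReal.mul_ne_top ENNReal.ofReal_ne_top (ENNReal.sum_ne_top.2 hfin)), ENNReal.toReal_mul,
      ENNReal.toReal_ofReal (by positivity), ENNReal.toReal_sum hfin] at h3
    refine le_trans (le_of_eq ?_) h3
    ring
  have hlim : Tendsto (fun δ : ℝ => (volume L).toReal + 2 * (ε / (1 + δ)) * Φ) (𝓝[>] 0)
      (𝓝 ((volume L).toReal + 2 * (ε / (1 + 0)) * Φ)) := by
    refine tendsto_nhdsWithin_of_tendsto_nhds (ContinuousAt.tendsto ?_)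
    have : ContinuousAt (fun δ : ℝ => ε / (1 + δ)) 0 :=
      continuousAt_const.div (by fun_prop) (by norm_num)
    fun_prop
  rw [add_zero, div_one] at hlim
  exact le_of_tendsto hlim (eventually_nhdsWithin_of_forall fun δ hδ => key δ hδ)

/-- The approximating zonotope must contain the ball and so may stick out slightly; the slack
`segmentConst n * ε < s` keeps it, with all its partial sums, inside the ball of radius s. -/
theorem measureReal_add_closedBall_le {n : ℕ} {L : Set (Euc (n + 1))} (hL : IsCompact L)
    (hLc : Convex ℝ L) {ε s : ℝ} (hε : 0 ≤ ε) (hs : segmentConst n * ε < s) :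
    (volume (L + Metric.closedBall 0 (segmentConst n * ε))).toReal ≤
      (volume L).toReal + 2 * ε * ∫ g : OrthGroup (n + 1),
        (volume (shadowMap n.le_succ g '' (L + Metric.closedBall 0 s))).toReal
          ∂(orthHaar (n + 1)) := by
  have hM : IsCompact (L + Metric.closedBall 0 s) := hL.add (isCompact_closedBall _ _)
  obtain ⟨g, hg1, hg2⟩ := exists_equidistributed
    (measurable_volume_shadowMap_image n.le_succ hM).ennreal_toReal
    (integrable_volume_shadowMap_image n.le_succ hM)
  have hc := segmentConst_pos n
  set Φ := ∫ g : OrthGroup (n + 1),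
    (volume (shadowMap n.le_succ g '' (L + Metric.closedBall 0 s))).toReal ∂(orthHaar (n + 1))
  have hdiv : ContinuousAt (fun δ : ℝ => ε / (1 - δ)) 0 :=
    continuousAt_const.div (by fun_prop) (by norm_num)
  -- Stretching the segments by 1/(1 - δ) makes the zonotope contain the ball.
  have key : ∀ δ > 0, δ < 1 → segmentConst n * (1 + δ) * (ε / (1 - δ)) < s →
      (volume (L + Metric.closedBall 0 (segmentConst n * ε))).toReal ≤
        (volume L).toReal + 2 * (ε / (1 - δ)) * Φ := by
    intro δ hδ hδ1 hδs
    have h1δ : 0 < 1 - δ := by linarith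
    refine ge_of_tendsto ((hg1.const_mul (2 * (ε / (1 - δ)))).const_add (volume L).toReal) ?_
    filter_upwards [hg2 (segmentConst n * δ) (by positivity)] with N hN
    have hη : 0 ≤ ε / (1 - δ) * (N : ℝ)⁻¹ := by positivity
    have hsub : Metric.closedBall 0 (segmentConst n * ε) ⊆ zonotope (ε / (1 - δ) * (N : ℝ)⁻¹)
        (fun j => (g j : Euc (n + 1) →L[ℝ] Euc (n + 1)) (lastVec n)) N := by
      refine closedBall_subset_zonotope hη fun w => ?_
      have h1 := (abs_le.1 (hN w)).1
      rw [mul_assoc (ε / (1 - δ))]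
      calc segmentConst n * ε * ‖w‖
          = ε / (1 - δ) * (-(segmentConst n * δ * ‖w‖) + segmentConst n * ‖w‖) := by
            field_simp; ring
        _ ≤ _ := by gcongr; linarith
    have hsub' : zonotope (ε / (1 - δ) * (N : ℝ)⁻¹)
        (fun j => (g j : Euc (n + 1) →L[ℝ] Euc (n + 1)) (lastVec n)) N ⊆
        Metric.closedBall 0 s := by
      refine (zonotope_subset_closedBall (r := segmentConst n * (1 + δ) * (ε / (1 - δ)))
        (by positivity) fun w => ?_).trans (Metric.closedBall_subset_closedBall hδs.le)
      have h1 := (abs_le.1 (hN w)).2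
      rw [mul_assoc (ε / (1 - δ))]
      calc _ ≤ ε / (1 - δ) * (segmentConst n * δ * ‖w‖ + segmentConst n * ‖w‖) := by
            gcongr; linarith
        _ = _ := by ring
    have h2 := (measure_mono (add_subset_add_left hsub)).trans
      (volume_add_zonotope_le hL hLc hη g N (add_subset_add_left hsub'))
    have hfin : ∀ j ∈ Finset.range N,
        volume (shadowMap n.le_succ (g j) '' (L + Metric.closedBall 0 s)) ≠ ⊤ := fun j _ =>
      (shadowMap_image_isCompact n.le_succ _ hM).measure_lt_top.ne
    have hne := ENNReal.mul_ne_top (a := ENNReal.ofReal (2 * (ε / (1 - δ) * (N : ℝ)⁻¹)))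
      ENNReal.ofReal_ne_top (ENNReal.sum_ne_top.2 hfin)
    have h3 := ENNReal.toReal_mono (ENNReal.add_ne_top.2 ⟨hL.measure_lt_top.ne, hne⟩) h2
    rw [ENNReal.toReal_add hL.measure_lt_top.ne hne, ENNReal.toReal_mul,
      ENNReal.toReal_ofReal (by positivity), ENNReal.toReal_sum hfin] at h3
    refine h3.trans (le_of_eq ?_)
    ring
  have hlim : Tendsto (fun δ : ℝ => (volume L).toReal + 2 * (ε / (1 - δ)) * Φ) (𝓝[>] 0)
      (𝓝 ((volume L).toReal + 2 * (ε / (1 - 0)) * Φ)) := by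
    refine tendsto_nhdsWithin_of_tendsto_nhds (ContinuousAt.tendsto ?_)
    fun_prop
  rw [sub_zero, div_one] at hlim
  refine ge_of_tendsto hlim ?_
  have hev : ∀ᶠ δ : ℝ in 𝓝 0, segmentConst n * (1 + δ) * (ε / (1 - δ)) < s := by
    have : ContinuousAt (fun δ : ℝ => segmentConst n * (1 + δ) * (ε / (1 - δ))) 0 := by fun_prop
    exact this.eventually_lt continuousAt_const (by simpa using hs)
  filter_upwards [self_mem_nhdsWithin, nhdsWithin_le_nhds hev,
    nhdsWithin_le_nhds (eventually_lt_nhds (zero_lt_one (α := ℝ)))] with δ h1 h2 h3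
  exact key δ h1 h3 h2

/-- A function whose increments are squeezed between those given by the derivative of a polynomial
at the two ends differs from the polynomial by a constant. -/
theorem eq_eval_of_increment_bounds {V : ℝ → ℝ} {p : Polynomial ℝ} (h0 : V 0 = p.eval 0)
    (hlow : ∀ a b, 0 ≤ a → a ≤ b → (b - a) * p.derivative.eval a ≤ V b - V a)
    (hupp : ∀ a b s, 0 ≤ a → a ≤ b → b < s → V b - V a ≤ (b - a) * p.derivative.eval s)
    {x : ℝ} (hx : 0 ≤ x) : V x = p.eval x := by
  set d : ℝ → ℝ := fun t => p.derivative.eval t with hd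
  have hdc : Continuous d := p.derivative.continuous
  -- Continuity of the derivative lets s decrease to b.
  have hupp' : ∀ a b, 0 ≤ a → a ≤ b → V b - V a ≤ (b - a) * d b := by
    intro a b ha hab
    have : Tendsto (fun s => (b - a) * d s) (𝓝[>] b) (𝓝 ((b - a) * d b)) :=
      tendsto_nhdsWithin_of_tendsto_nhds (by fun_prop : Continuous fun s => (b - a) * d s).continuousAt
    exact ge_of_tendsto this (eventually_nhdsWithin_of_forall fun s hs => hupp a b s ha hab hs)
  -- The first-order error is o(|b - a|) by continuity of d, whichever of a, b is larger; so V has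
  -- derivative d on [0, ∞), and V - p has derivative zero.
  have hbound : ∀ a b, 0 ≤ a → 0 ≤ b →
      |V b - V a - (b - a) * d a| ≤ |d b - d a| * |b - a| := by
    intro a b ha hb
    rw [← abs_mul]
    rcases le_total a b with hab | hab
    · have h1 := hlow a b ha hab
      have h2 := hupp' a b ha hab
      rw [abs_of_nonneg (by linarith)]
      refine le_trans ?_ (le_abs_self _)
      linarith
    · have h1 := hlow b a hb hab
      have h2 := hupp' b a hb hab
      change (a - b) * d b ≤ _ at h1
      rw [abs_of_nonneg (by linarith)]
      refine le_trans ?_ (le_abs_self _)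
      linarith
  have hderiv : ∀ a ∈ Ici (0 : ℝ), HasDerivWithinAt V (d a) (Ici 0) a := by
    intro a ha
    rw [hasDerivWithinAt_iff_isLittleO, Asymptotics.isLittleO_iff]
    intro c hc
    have := Metric.tendsto_nhds.1 (hdc.tendsto a) c hc
    filter_upwards [nhdsWithin_le_nhds this, self_mem_nhdsWithin] with b hb hb0
    rw [smul_eq_mul, Real.norm_eq_abs, Real.norm_eq_abs]
    refine (hbound a b ha hb0).trans ?_
    gcongr
    exact hb.le
  have hdiff : ∀ a ∈ Ici (0 : ℝ), HasDerivWithinAt (fun t => V t - p.eval t) 0 (Ici 0) a := by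
    intro a ha
    have h := (hderiv a ha).sub (p.hasDerivAt a).hasDerivWithinAt
    rwa [sub_self] at h
  have := (convex_Ici (0 : ℝ)).norm_image_sub_le_of_norm_hasDerivWithin_le (C := 0) hdiff
    (fun a _ => by simp) (mem_Ici.2 le_rfl) (mem_Ici.2 hx)
  rw [zero_mul, norm_le_zero_iff, h0, sub_self, sub_zero] at this
  linarith

/-! ### The Steiner formula -/

theorem isSteinerPolynomial_iff {E : Type*} [NormedAddCommGroup E] [InnerProductSpace ℝ E]
    [FiniteDimensional ℝ E] [MeasurableSpace E] [BorelSpace E] {K : Set E} {p : Polynomial ℝ} :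
    IsSteinerPolynomial K p ↔
      ∀ ρ : ℝ, 0 ≤ ρ → (volume (K + Metric.closedBall (0 : E) ρ)).toReal = p.eval ρ := by
  refine forall₂_congr fun ρ hρ => ?_
  rw [smul_unitClosedBall_of_nonneg hρ]

/-- The coefficients of the polynomials of degree at most `n` are linear combinations of the values
at `0, …, n`. -/
theorem exists_coeff_eq_sum_eval (n : ℕ) : ∃ a : ℕ → ℕ → ℝ, ∀ p : Polynomial ℝ, p.natDegree ≤ n →
    ∀ j, p.coeff j = ∑ i ∈ Finset.range (n + 1), p.eval (i : ℝ) * a i j := by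
  refine ⟨fun i j => (Lagrange.basis (Finset.range (n + 1)) (fun i : ℕ => (i : ℝ)) i).coeff j,
    fun p hp j => ?_⟩
  have hdeg : p.degree < (Finset.range (n + 1)).card := by
    rw [Finset.card_range]
    exact p.degree_le_natDegree.trans_lt (by exact_mod_cast Nat.lt_succ_of_le hp)
  have h := Lagrange.eq_interpolate (s := Finset.range (n + 1)) (v := fun i : ℕ => (i : ℝ))
    (f := p) (fun i _ j _ h => Nat.cast_injective h) hdeg
  conv_lhs => rw [h, Lagrange.interpolate_apply, Polynomial.finsetSum_coeff]
  simp only [Polynomial.coeff_C_mul]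

/-- By interpolation the coefficients are fixed combinations of shadow volumes of K + iB, i = 0, …,
k, so an arbitrary choice of q is automatically measurable. -/
theorem integrable_coeff_shadow {n k : ℕ} (hkn : k ≤ n) {K : Set (Euc n)} (hK : IsCompact K)
    {q : OrthGroup n → Polynomial ℝ} (hq : ∀ g, IsSteinerPolynomial (shadowMap hkn g '' K) (q g))
    (hdeg : ∀ g, (q g).natDegree ≤ k) (j : ℕ) :
    Integrable (fun g => (q g).coeff j) (orthHaar n) := by
  obtain ⟨a, ha⟩ := exists_coeff_eq_sum_eval k
  simp only [fun g => ha (q g) (hdeg g) j]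
  refine integrable_finsetSum _ fun i _ => Integrable.mul_const ?_ _
  refine (integrable_volume_shadowMap_image hkn
    (hK.add (isCompact_closedBall (0 : Euc n) (i : ℝ)))).congr (Eventually.of_forall fun g => ?_)
  simp only [shadowMap_image_add_closedBall]
  exact isSteinerPolynomial_iff.1 (hq g) i i.cast_nonneg

/-- If all shadows of `K` on hyperplanes have a Steiner polynomial, integrating them gives one for
`K`. -/
theorem isSteinerPolynomial_of_shadow {n : ℕ} {K : Set (Euc (n + 1))} (hK : IsCompact K)
    (hKc : Convex ℝ K) {q : OrthGroup (n + 1) → Polynomial ℝ}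
    (hq : ∀ g, IsSteinerPolynomial (shadowMap n.le_succ g '' K) (q g))
    (hdeg : ∀ g, (q g).natDegree ≤ n) :
    IsSteinerPolynomial K (Polynomial.C (volume K).toReal + ∑ j ∈ Finset.range (n + 1),
      Polynomial.C (2 / segmentConst n / (j + 1) * ∫ g, (q g).coeff j ∂(orthHaar (n + 1))) *
        Polynomial.X ^ (j + 1)) := by
  have hc := segmentConst_pos n
  have hΦ : ∀ ρ : ℝ, 0 ≤ ρ → ∫ g : OrthGroup (n + 1),
      (volume (shadowMap n.le_succ g '' (K + Metric.closedBall 0 ρ))).toReal ∂(orthHaar (n + 1)) =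
      ∑ j ∈ Finset.range (n + 1), (∫ g, (q g).coeff j ∂(orthHaar (n + 1))) * ρ ^ j := by
    intro ρ hρ
    have h1 : ∀ g : OrthGroup (n + 1),
        (volume (shadowMap n.le_succ g '' (K + Metric.closedBall 0 ρ))).toReal =
        ∑ j ∈ Finset.range (n + 1), (q g).coeff j * ρ ^ j := by
      intro g
      rw [shadowMap_image_add_closedBall, isSteinerPolynomial_iff.1 (hq g) ρ hρ,
        Polynomial.eval_eq_sum_range' (Nat.lt_succ_of_le (hdeg g))]
    simp only [h1]
    rw [integral_finsetSum _ fun j _ => (integrable_coeff_shadow _ hK hq hdeg j).mul_const _]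
    simp only [integral_mul_const]
  rw [isSteinerPolynomial_iff]
  intro ρ hρ
  refine eq_eval_of_increment_bounds
    (V := fun ρ => (volume (K + Metric.closedBall 0 ρ)).toReal) ?_ ?_ ?_ hρ
  · simp [Polynomial.eval_finsetSum]
  all_goals
    simp only [Polynomial.derivative_add, Polynomial.derivative_C, zero_add,
      Polynomial.derivative_sum, Polynomial.derivative_C_mul_X_pow, Polynomial.eval_finsetSum,
      Polynomial.eval_mul, Polynomial.eval_C, Polynomial.eval_pow, Polynomial.eval_X,
      Nat.add_sub_cancel]
    -- The derivative of the candidate polynomial is 2/c times the mean shadow volume of the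
    -- parallel body; the factor 1/(j+1) cancels on differentiating.
    have hsum : ∀ s : ℝ, 0 ≤ s → ∑ j ∈ Finset.range (n + 1),
        (2 / segmentConst n / (j + 1) * ∫ g, (q g).coeff j ∂(orthHaar (n + 1))) *
          ((j + 1 : ℕ) : ℝ) * s ^ j = 2 / segmentConst n * ∫ g : OrthGroup (n + 1),
        (volume (shadowMap n.le_succ g '' (K + Metric.closedBall 0 s))).toReal
          ∂(orthHaar (n + 1)) := by
      intro s hs
      rw [hΦ s hs, Finset.mul_sum]
      refine Finset.sum_congr rfl fun j _ => ?_
      push_cast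
      have : (j : ℝ) + 1 ≠ 0 := by positivity
      field_simp
    have hballs : ∀ a b : ℝ, 0 ≤ a → 0 ≤ b →
        K + Metric.closedBall 0 a + Metric.closedBall 0 b = K + Metric.closedBall 0 (a + b) := by
      intro a b ha hb
      rw [add_assoc, closedBall_add_closedBall ha hb, add_zero]
  · intro a b ha hab
    -- With this ε the added ball has radius exactly b - a.
    have h := measureReal_add_closedBall_ge (hK.add (isCompact_closedBall 0 a))
      (hKc.add (convex_closedBall 0 a)) (ε := (b - a) / segmentConst n)
      (div_nonneg (by linarith) hc.le)
    rw [mul_div_cancel₀ _ hc.ne', hballs a _ ha (by linarith), add_sub_cancel] at h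
    rw [hsum a ha]
    refine le_trans (le_of_eq ?_) (le_sub_iff_add_le'.2 h)
    ring
  · intro a b s ha hab hs
    have h := measureReal_add_closedBall_le (hK.add (isCompact_closedBall 0 a))
      (hKc.add (convex_closedBall 0 a)) (ε := (b - a) / segmentConst n) (s := s - a)
      (div_nonneg (by linarith) hc.le) (by rw [mul_div_cancel₀ _ hc.ne']; linarith)
    rw [mul_div_cancel₀ _ hc.ne', hballs a _ ha (by linarith), add_sub_cancel,
      hballs a _ ha (by linarith), add_sub_cancel] at h
    rw [hsum s (by linarith)]
    refine (sub_le_iff_le_add'.2 h).trans (le_of_eq ?_)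
    ring

theorem shadowMap_image_convex {n k : ℕ} (hkn : k ≤ n) (g : OrthGroup n) {K : Set (Euc n)}
    (hK : Convex ℝ K) : Convex ℝ (shadowMap hkn g '' K) :=
  hK.linear_image (shadowMap hkn g).toLinearMap

/-- **Steiner formula**: compact convex sets have a Steiner polynomial, with nonnegative
coefficients and of degree at most the dimension. -/
theorem exists_isSteinerPolynomial (n : ℕ) {K : Set (Euc n)} (hK : IsCompact K)
    (hKc : Convex ℝ K) (hne : K.Nonempty) :
    ∃ p : Polynomial ℝ, IsSteinerPolynomial K p ∧ p.natDegree ≤ n ∧ ∀ j, 0 ≤ p.coeff j := by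
  induction n with
  | zero =>
    refine ⟨Polynomial.C (volume (univ : Set (Euc 0))).toReal, ?_, by simp, fun j => ?_⟩
    · rw [isSteinerPolynomial_iff]
      intro ρ hρ
      have : K + Metric.closedBall 0 ρ = univ := by
        obtain ⟨x, hx⟩ := hne
        refine Subset.antisymm (subset_univ _) fun y _ => ?_
        exact ⟨x, hx, 0, by simpa using hρ, Subsingleton.elim _ _⟩
      rw [this, Polynomial.eval_C]
    · rw [Polynomial.coeff_C]
      split_ifs <;> simp
  | succ n ih =>
    choose q hq hdeg hnonneg using fun g : OrthGroup (n + 1) =>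
      ih (shadowMap_image_isCompact n.le_succ g hK) (shadowMap_image_convex _ g hKc) (hne.image _)
    refine ⟨_, isSteinerPolynomial_of_shadow hK hKc hq hdeg, ?_, fun j => ?_⟩
    · refine (Polynomial.natDegree_add_le _ _).trans (max_le (by simp) ?_)
      refine Polynomial.natDegree_sum_le_of_forall_le _ _ fun j hj => ?_
      exact (Polynomial.natDegree_C_mul_X_pow_le _ _).trans (Finset.mem_range.1 hj)
    · have hc := segmentConst_pos n
      rw [Polynomial.coeff_add, Polynomial.finsetSum_coeff, Polynomial.coeff_C]
      refine add_nonneg (by split_ifs <;> simp) (Finset.sum_nonneg fun i _ => ?_)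
      rw [Polynomial.coeff_C_mul_X_pow]
      split_ifs
      · exact mul_nonneg (by positivity) (integral_nonneg fun g => hnonneg g i)
      · exact le_rfl

theorem ballVol_pos (n : ℕ) : 0 < ballVol n :=
  ENNReal.toReal_pos (Metric.measure_closedBall_pos volume _ one_pos).ne'
    measure_closedBall_lt_top.ne

theorem isSteinerPolynomial_singleton_zero (n : ℕ) :
    IsSteinerPolynomial ({0} : Set (Euc n)) (Polynomial.C (ballVol n) * Polynomial.X ^ n) := by
  rw [isSteinerPolynomial_iff]
  intro ρ hρ
  rw [singleton_add, image_congr (fun a _ => zero_add a), image_id', ballVol,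
    Measure.addHaar_closedBall' _ _ hρ, ENNReal.toReal_mul, ENNReal.toReal_ofReal (by positivity),
    Polynomial.eval_mul, Polynomial.eval_C, Polynomial.eval_pow, Polynomial.eval_X,
    finrank_euclideanSpace, Fintype.card_fin, mul_comm]

theorem coeff_succ_isSteinerPolynomial {n : ℕ} {K : Set (Euc (n + 1))} (hK : IsCompact K)
    (hKc : Convex ℝ K) {q : OrthGroup (n + 1) → Polynomial ℝ}
    (hq : ∀ g, IsSteinerPolynomial (shadowMap n.le_succ g '' K) (q g))
    (hdeg : ∀ g, (q g).natDegree ≤ n) {p : Polynomial ℝ} (hp : IsSteinerPolynomial K p) {j : ℕ}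
    (hj : j ≤ n) :
    p.coeff (j + 1) = 2 / segmentConst n / (j + 1) * ∫ g, (q g).coeff j ∂(orthHaar (n + 1)) := by
  rw [hp.unique (isSteinerPolynomial_of_shadow hK hKc hq hdeg), Polynomial.coeff_add,
    Polynomial.coeff_C_succ, zero_add, Polynomial.finsetSum_coeff,
    Finset.sum_eq_single_of_mem j (Finset.mem_range.2 (Nat.lt_succ_of_le hj))]
  · rw [Polynomial.coeff_C_mul_X_pow, if_pos rfl]
  · intro i _ hij
    rw [Polynomial.coeff_C_mul_X_pow, if_neg]
    omega

/-- Calibration on a point: its Steiner polynomials κ_{n+1} ρⁿ⁺¹ and κ_n ρⁿ are known, and their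
leading coefficients are compared. -/
theorem two_div_segmentConst (n : ℕ) :
    2 / segmentConst n / (n + 1) = ballVol (n + 1) / ballVol n := by
  have h := coeff_succ_isSteinerPolynomial (n := n) (K := {0}) isCompact_singleton
    (convex_singleton 0) (q := fun _ => Polynomial.C (ballVol n) * Polynomial.X ^ n)
    (fun g => by simpa using isSteinerPolynomial_singleton_zero n)
    (fun g => Polynomial.natDegree_C_mul_X_pow_le _ _)
    (isSteinerPolynomial_singleton_zero (n + 1)) le_rfl
  have := ballVol_pos n
  rw [eq_div_iff this.ne']
  simpa using h.symm

/-- Kubota's formula for projections onto hyperplanes. -/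
theorem quermass_succ_eq_integral {n j : ℕ} (hj : j ≤ n) {K : Set (Euc (n + 1))}
    (hK : IsCompact K) (hKc : Convex ℝ K) (hne : K.Nonempty) :
    quermass (j + 1) K = ballVol (n + 1) / ballVol n *
      ∫ g, quermass j (shadowMap n.le_succ g '' K) ∂(orthHaar (n + 1)) := by
  choose q hq hdeg _ using fun g : OrthGroup (n + 1) => exists_isSteinerPolynomial n
    (shadowMap_image_isCompact n.le_succ g hK) (shadowMap_image_convex _ g hKc) (hne.image _)
  obtain ⟨p, hp, -⟩ := exists_isSteinerPolynomial (n + 1) hK hKc hne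
  rw [quermass_eq hp, coeff_succ_isSteinerPolynomial hK hKc hq hdeg hp hj,
    ← two_div_segmentConst]
  simp only [fun g => quermass_eq (hq g), finrank_euclideanSpace, Fintype.card_fin,
    integral_div]
  -- This identity reconciles the binomial normalisations of quermassintegrals in dimensions n and n
  -- + 1.
  have h1 : ((n : ℝ) + 1) * n.choose j = (n + 1).choose (j + 1) * ((j : ℝ) + 1) := by
    exact_mod_cast Nat.add_one_mul_choose_eq n j
  have h2 : ((n.choose j : ℕ) : ℝ) ≠ 0 := by exact_mod_cast (Nat.choose_pos hj).ne'
  have h3 : (((n + 1).choose (j + 1) : ℕ) : ℝ) ≠ 0 := by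
    exact_mod_cast (Nat.choose_pos (Nat.succ_le_succ hj)).ne'
  have h4 : (j : ℝ) + 1 ≠ 0 := by positivity
  have h5 : (n : ℝ) + 1 ≠ 0 := by positivity
  have hc := (segmentConst_pos n).ne'
  field_simp
  linear_combination (∫ g, (q g).coeff j ∂(orthHaar (n + 1))) * h1

/-! ### Quermassintegrals as functions of the set -/

section isometry

variable {E F : Type*} [NormedAddCommGroup E] [InnerProductSpace ℝ E] [FiniteDimensional ℝ E]
  [MeasurableSpace E] [BorelSpace E] [NormedAddCommGroup F] [InnerProductSpace ℝ F]
  [FiniteDimensional ℝ F] [MeasurableSpace F] [BorelSpace F]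

theorem isSteinerPolynomial_image_iff (e : E ≃ₗᵢ[ℝ] F) {K : Set E} {p : Polynomial ℝ} :
    IsSteinerPolynomial (e '' K) p ↔ IsSteinerPolynomial K p := by
  rw [isSteinerPolynomial_iff, isSteinerPolynomial_iff]
  refine forall₂_congr fun ρ _ => ?_
  have h1 : e '' K + Metric.closedBall 0 ρ = e '' (K + Metric.closedBall 0 ρ) := by
    rw [image_add, e.image_closedBall, map_zero]
  have h2 : volume (e '' (K + Metric.closedBall 0 ρ)) = volume (K + Metric.closedBall 0 ρ) := by
    rw [← e.symm.measurePreserving.measure_preimage_equiv (f := e.symm.toMeasurableEquiv)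
      (K + Metric.closedBall 0 ρ)]
    exact congrArg _ (e.toEquiv.image_eq_preimage_symm _)
  rw [h1, h2]

theorem quermass_image (e : E ≃ₗᵢ[ℝ] F) (j : ℕ) (K : Set E) :
    quermass j (e '' K) = quermass j K := by
  by_cases h : ∃ p : Polynomial ℝ, IsSteinerPolynomial K p
  · obtain ⟨p, hp⟩ := h
    rw [quermass_eq hp, quermass_eq ((isSteinerPolynomial_image_iff e).2 hp),
      e.toLinearEquiv.finrank_eq]
  · have h' : ¬∃ p : Polynomial ℝ, IsSteinerPolynomial (e '' K) p := by
      simpa only [isSteinerPolynomial_image_iff] using h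
    rw [quermass, quermass, dif_neg h, dif_neg h']

theorem quermass_empty (j : ℕ) : quermass j (∅ : Set E) = 0 := by
  rw [quermass_eq (p := 0) (fun ρ _ => by simp)]
  simp

end isometry

theorem quermass_nonneg {n : ℕ} (j : ℕ) {K : Set (Euc n)} (hK : IsCompact K)
    (hKc : Convex ℝ K) : 0 ≤ quermass j K := by
  rcases K.eq_empty_or_nonempty with rfl | hne
  · rw [quermass_empty]
  · obtain ⟨p, hp, -, h⟩ := exists_isSteinerPolynomial n hK hKc hne
    rw [quermass_eq hp]
    exact div_nonneg (h j) (Nat.cast_nonneg _)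

/-- The quermassintegrals are linear combinations of volumes of parallel bodies. -/
theorem exists_quermass_eq_sum_volume (n j : ℕ) : ∃ b : ℕ → ℝ, ∀ K : Set (Euc n), IsCompact K →
    Convex ℝ K → quermass j K = ∑ i ∈ Finset.range (n + 1),
      (volume (K + Metric.closedBall 0 (i : ℝ))).toReal * b i := by
  obtain ⟨a, ha⟩ := exists_coeff_eq_sum_eval n
  refine ⟨fun i => a i j / n.choose j, fun K hK hKc => ?_⟩
  rcases K.eq_empty_or_nonempty with rfl | hne
  · simp [quermass_empty]
  · obtain ⟨p, hp, hdeg, -⟩ := exists_isSteinerPolynomial n hK hKc hne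
    rw [quermass_eq hp, ha p hdeg, finrank_euclideanSpace, Fintype.card_fin, Finset.sum_div]
    refine Finset.sum_congr rfl fun i _ => ?_
    rw [isSteinerPolynomial_iff.1 hp i i.cast_nonneg, mul_div_assoc]

/-- The weights depend on neither K nor g, so measurability and integrability in g reduce to those
of shadow volumes. -/
theorem quermass_shadowMap_image_eq_sum {n k : ℕ} (hkn : k ≤ n) (j : ℕ) :
    ∃ b : ℕ → ℝ, ∀ K : Set (Euc n), IsCompact K → Convex ℝ K → ∀ g : OrthGroup n,
      quermass j (shadowMap hkn g '' K) = ∑ i ∈ Finset.range (k + 1),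
        (volume (shadowMap hkn g '' (K + Metric.closedBall 0 (i : ℝ)))).toReal * b i := by
  obtain ⟨b, hb⟩ := exists_quermass_eq_sum_volume k j
  refine ⟨b, fun K hK hKc g => ?_⟩
  simp only [shadowMap_image_add_closedBall]
  exact hb _ (shadowMap_image_isCompact hkn g hK) (shadowMap_image_convex hkn g hKc)

section shadow

variable {n k : ℕ} (hkn : k ≤ n) (j : ℕ) {K : Set (Euc n)}

theorem measurable_quermass_shadow (hK : IsCompact K) (hKc : Convex ℝ K) :
    Measurable fun g : OrthGroup n => quermass j (shadowMap hkn g '' K) := by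
  obtain ⟨b, hb⟩ := quermass_shadowMap_image_eq_sum hkn j
  simp only [hb K hK hKc]
  exact Finset.measurable_fun_sum _ fun i _ => (measurable_volume_shadowMap_image hkn
    (hK.add (isCompact_closedBall 0 (i : ℝ)))).ennreal_toReal.mul_const _

theorem integrable_quermass_shadow (hK : IsCompact K) (hKc : Convex ℝ K) :
    Integrable (fun g : OrthGroup n => quermass j (shadowMap hkn g '' K)) (orthHaar n) := by
  obtain ⟨b, hb⟩ := quermass_shadowMap_image_eq_sum hkn j
  simp only [hb K hK hKc]
  exact integrable_finsetSum _ fun i _ => (integrable_volume_shadowMap_image hkn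
    (hK.add (isCompact_closedBall 0 (i : ℝ)))).mul_const _

end shadow

/-! ### Kubota's formula on the orthogonal group -/

theorem norm_sq_fibrePoint {n : ℕ} (y : Euc n) (t : ℝ) :
    ‖fibrePoint y t‖ ^ 2 = ‖y‖ ^ 2 + t ^ 2 := by
  rw [EuclideanSpace.norm_sq_eq, EuclideanSpace.norm_sq_eq, Fin.sum_univ_castSucc]
  simp

theorem fibrePoint_eq {n : ℕ} (y : Euc n) (t : ℝ) :
    fibrePoint y t = coordIncl n.le_succ y + t • lastVec n := by
  have h : coordIncl n.le_succ y = fibrePoint y 0 := by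
    have h1 := fibrePoint_coordProj (coordIncl n.le_succ y)
    rw [coordProj_coordIncl] at h1
    have h2 := norm_sq_fibrePoint y ((coordIncl n.le_succ y) (Fin.last n))
    rw [h1, norm_coordIncl, left_eq_add] at h2
    rw [← h1, pow_eq_zero_iff two_ne_zero |>.1 h2]
  rw [h, fibrePoint_add_smul, zero_add]

/-- The element of `O(n + 1)` that acts as `h ∈ O(n)` on the first coordinates and fixes the last
one. -/
def orthExtend {n : ℕ} (h : OrthGroup n) : OrthGroup (n + 1) :=
  Unitary.linearIsometryEquiv.symm (LinearIsometry.toLinearIsometryEquiv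
    { toLinearMap := (coordIncl n.le_succ ∘L (h : Euc n →L[ℝ] Euc n) ∘L coordProj n.le_succ +
        (EuclideanSpace.proj (Fin.last n) : Euc (n + 1) →L[ℝ] ℝ).smulRight
          (lastVec n)).toLinearMap
      norm_map' := fun x => by
        have h1 := norm_sq_fibrePoint ((h : Euc n →L[ℝ] Euc n) (coordProj n.le_succ x))
          (x (Fin.last n))
        rw [orthGroup_norm_apply, ← norm_sq_fibrePoint, fibrePoint_coordProj, fibrePoint_eq] at h1
        exact (sq_eq_sq₀ (norm_nonneg _) (norm_nonneg _)).1 h1 } rfl)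

theorem coe_orthExtend {n : ℕ} (h : OrthGroup n) :
    (orthExtend h : Euc (n + 1) →L[ℝ] Euc (n + 1)) =
      coordIncl n.le_succ ∘L (h : Euc n →L[ℝ] Euc n) ∘L coordProj n.le_succ +
        (EuclideanSpace.proj (Fin.last n) : Euc (n + 1) →L[ℝ] ℝ).smulRight (lastVec n) := rfl

theorem continuous_orthExtend (n : ℕ) : Continuous (orthExtend : OrthGroup n → _) := by
  refine Continuous.subtype_mk ?_ _
  refine Continuous.add ?_ continuous_const
  exact continuous_const.clm_comp (continuous_subtype_val.clm_comp continuous_const)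

theorem coordProj_orthExtend {n : ℕ} (h : OrthGroup n) (x : Euc (n + 1)) :
    coordProj n.le_succ ((orthExtend h : Euc (n + 1) →L[ℝ] Euc (n + 1)) x) =
      (h : Euc n →L[ℝ] Euc n) (coordProj n.le_succ x) := by
  have : (orthExtend h : Euc (n + 1) →L[ℝ] Euc (n + 1)) x =
      fibrePoint ((h : Euc n →L[ℝ] Euc n) (coordProj n.le_succ x)) (x (Fin.last n)) := by
    rw [coe_orthExtend, fibrePoint_eq]; rfl
  rw [this, coordProj_fibrePoint]

/-- `coordProj` intertwines `orthExtend h` with h, so successive projections collapse into one. -/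
theorem shadowMap_mul_orthExtend {n k : ℕ} (hkn : k ≤ n) (g : OrthGroup (n + 1))
    (h : OrthGroup n) (x : Euc (n + 1)) :
    shadowMap (hkn.trans n.le_succ) (g * orthExtend h) x =
      shadowMap hkn h (shadowMap n.le_succ g x) := by
  set z := ((orthExtend h)⁻¹ : OrthGroup (n + 1)).1 ((g⁻¹ : OrthGroup (n + 1)).1 x) with hz
  have h1 : ((g * orthExtend h)⁻¹ : OrthGroup (n + 1)).1 x = z := by
    rw [mul_inv_rev]; rfl
  have h2 : coordProj n.le_succ z = (h⁻¹ : OrthGroup n).1 (shadowMap n.le_succ g x) := by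
    have h3 := coordProj_orthExtend h z
    rw [hz, orthGroup_apply_inv_apply, ← hz] at h3
    have h4 := congrArg (h⁻¹ : OrthGroup n).1 h3
    rw [orthGroup_inv_apply_apply] at h4
    exact h4.symm
  have h5 : shadowMap hkn h (shadowMap n.le_succ g x) =
      coordProj hkn ((h⁻¹ : OrthGroup n).1 (shadowMap n.le_succ g x)) := rfl
  rw [h5, ← h2]
  have h6 : shadowMap (hkn.trans n.le_succ) (g * orthExtend h) x =
    coordProj (hkn.trans n.le_succ) (((g * orthExtend h)⁻¹ : OrthGroup (n + 1)).1 x) := rfl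
  rw [h6, h1]
  rfl

/-- After Fubini, for each fixed h right invariance removes `orthExtend h`, and the integral over h
has total mass 1. -/
theorem integral_integral_mul_orthExtend {n : ℕ} {F : OrthGroup (n + 1) → ℝ} (hF : Measurable F)
    (hint : Integrable F (orthHaar (n + 1))) :
    ∫ g, ∫ h, F (g * orthExtend h) ∂(orthHaar n) ∂(orthHaar (n + 1)) =
      ∫ g, F g ∂(orthHaar (n + 1)) := by
  have hc : Measurable fun p : OrthGroup (n + 1) × OrthGroup n => p.1 * orthExtend p.2 :=
    measurable_fst.mul ((continuous_orthExtend n).measurable.comp measurable_snd)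
  have hm : Measurable fun p : OrthGroup (n + 1) × OrthGroup n => F (p.1 * orthExtend p.2) :=
    Measurable.comp (g := F) hF hc
  rw [integral_integral_swap]
  · simp only [integral_mul_right_eq_self]
    simp
  · have h1 : ∀ h : OrthGroup n, Integrable (fun g => F (g * orthExtend h)) (orthHaar (n + 1)) :=
      fun h => hint.comp_mul_right (orthExtend h)
    refine (integrable_prod_iff' (f := fun p : OrthGroup (n + 1) × OrthGroup n =>
      F (p.1 * orthExtend p.2)) hm.aestronglyMeasurable).2 ⟨Eventually.of_forall h1, ?_⟩
    have : ∀ h : OrthGroup n, ∫ g, ‖F (g * orthExtend h)‖ ∂(orthHaar (n + 1)) =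
        ∫ g, ‖F g‖ ∂(orthHaar (n + 1)) := fun h =>
      integral_mul_right_eq_self (fun g => ‖F g‖) (orthExtend h)
    simp only [this]
    exact integrable_const _

theorem quermass_shadowMap_self {n : ℕ} (j : ℕ) (g : OrthGroup n) (K : Set (Euc n)) :
    quermass j (shadowMap le_rfl g '' K) = quermass j K := by
  rw [← quermass_image (Unitary.linearIsometryEquiv g⁻¹) j K]
  rfl

/-- **Cauchy–Kubota formula** on the orthogonal group. -/
theorem quermass_eq_integral_shadow {n k i : ℕ} (hik : i ≤ k) (hkn : k ≤ n) {K : Set (Euc n)}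
    (hK : IsCompact K) (hKc : Convex ℝ K) (hne : K.Nonempty) :
    quermass (n - i) K = kubotaConst n k *
      ∫ g, quermass (k - i) (shadowMap hkn g '' K) ∂(orthHaar n) := by
  induction n, hkn using Nat.le_induction with
  | base =>
    have := (ballVol_pos k).ne'
    simp [quermass_shadowMap_self, kubotaConst, this]
  | succ n hkn ih =>
    have hF := fun g : OrthGroup (n + 1) => ih (shadowMap_image_isCompact n.le_succ g hK)
      (shadowMap_image_convex n.le_succ g hKc) (hne.image _)
    -- Truncated subtraction is harmless here because i ≤ k ≤ n.
    have hstep : n + 1 - i = (n - i) + 1 := by omega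
    rw [hstep, quermass_succ_eq_integral (Nat.sub_le n i) hK hKc hne]
    simp only [hF, integral_const_mul]
    rw [← integral_integral_mul_orthExtend
      (measurable_quermass_shadow (hkn.trans n.le_succ) (k - i) hK hKc)
      (integrable_quermass_shadow (hkn.trans n.le_succ) (k - i) hK hKc), ← mul_assoc]
    congr 1
    · have h1 := (ballVol_pos n).ne'
      have h2 := (ballVol_pos k).ne'
      rw [kubotaConst, kubotaConst]
      field_simp
    · refine integral_congr_ae (Eventually.of_forall fun g => ?_)
      refine integral_congr_ae (Eventually.of_forall fun h => ?_)
      simp only [image_image]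
      exact congrArg _ (image_congr fun x _ => (shadowMap_mul_orthExtend hkn g h x).symm)

/-! ### Passing to the Grassmannian -/

theorem coordIncl_single {n k : ℕ} (hkn : k ≤ n) (j : Fin k) :
    coordIncl hkn (EuclideanSpace.single j 1) = EuclideanSpace.single (Fin.castLE hkn j) 1 := by
  refine ext_inner_right ℝ fun x => ?_
  rw [inner_coordIncl]
  simp [EuclideanSpace.inner_single_left]

theorem coordIncl_mem_stdGrass {n k : ℕ} (hkn : k ≤ n) (y : Euc k) :
    coordIncl hkn y ∈ (stdGrass hkn).1 := by
  have hy : y = ∑ j, y j • EuclideanSpace.single j (1 : ℝ) := by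
    have := (EuclideanSpace.basisFun (Fin k) ℝ).sum_repr y
    simpa using this.symm
  rw [hy, map_sum]
  refine Submodule.sum_mem _ fun j _ => ?_
  rw [map_smul, coordIncl_single]
  refine Submodule.smul_mem _ _ (Submodule.subset_span ⟨j, ?_⟩)
  simp

theorem inner_shadowMap {n k : ℕ} (hkn : k ≤ n) (g : OrthGroup n) (y : Euc k) (x : Euc n) :
    inner ℝ y (shadowMap hkn g x) = inner ℝ ((g : Euc n →L[ℝ] Euc n) (coordIncl hkn y)) x := by
  have h1 : inner ℝ y (shadowMap hkn g x) =
      inner ℝ (coordIncl hkn y) ((g⁻¹ : OrthGroup n).1 x) := (inner_coordIncl hkn y _).symm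
  rw [h1, ← Unitary.inner_map_map g, orthGroup_apply_inv_apply]

/-- The parametrization of the subspace `g ℝᵏ` by `ℝᵏ`. -/
def orthActParam {n k : ℕ} (hkn : k ≤ n) (g : OrthGroup n) :
    Euc k ≃ₗᵢ[ℝ] (orthAct g (stdGrass hkn)).1 :=
  LinearIsometry.toLinearIsometryEquiv
    { toLinearMap := LinearMap.codRestrict _
        ((g : Euc n →L[ℝ] Euc n) ∘L coordIncl hkn).toLinearMap
        fun y => Submodule.mem_map_of_mem (coordIncl_mem_stdGrass hkn y)
      norm_map' := fun y => (orthGroup_norm_apply g _).trans (norm_coordIncl hkn y) }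
    (by rw [(orthAct g (stdGrass hkn)).2]; simp)

theorem coe_orthActParam {n k : ℕ} (hkn : k ≤ n) (g : OrthGroup n) (y : Euc k) :
    (orthActParam hkn g y : Euc n) = (g : Euc n →L[ℝ] Euc n) (coordIncl hkn y) := rfl

/-- Both points of the subspace have the same inner products with every vector of it. -/
theorem projSet_orthAct {n k : ℕ} (hkn : k ≤ n) (g : OrthGroup n) (K : Set (Euc n)) :
    projSet (orthAct g (stdGrass hkn)).1 K = orthActParam hkn g '' (shadowMap hkn g '' K) := by
  rw [projSet, image_image]
  refine image_congr fun x _ => ?_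
  refine ext_inner_left ℝ fun v => ?_
  obtain ⟨y, rfl⟩ := (orthActParam hkn g).surjective v
  rw [LinearIsometryEquiv.inner_map_map, inner_shadowMap, ← coe_orthActParam,
    Submodule.inner_orthogonalProjectionOnto_eq_of_mem_left]

theorem quermass_projSet_orthAct {n k : ℕ} (hkn : k ≤ n) (j : ℕ) (g : OrthGroup n)
    (K : Set (Euc n)) : quermass j (projSet (orthAct g (stdGrass hkn)).1 K) =
      quermass j (shadowMap hkn g '' K) := by
  rw [projSet_orthAct, quermass_image]

/-- An isometry between subspaces of equal dimension extends to the whole space. -/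
theorem orthAct_stdGrass_surjective {n k : ℕ} (hkn : k ≤ n) :
    Function.Surjective fun g : OrthGroup n => orthAct g (stdGrass hkn) := by
  intro L
  have hd : finrank ℝ L.1 = finrank ℝ (stdGrass hkn).1 := by rw [L.2, (stdGrass hkn).2]
  let e : (stdGrass hkn).1 ≃ₗᵢ[ℝ] L.1 := (stdOrthonormalBasis ℝ (stdGrass hkn).1).repr.trans
    ((stdOrthonormalBasis ℝ L.1).reindex (finCongr hd)).repr.symm
  let φ : (stdGrass hkn).1 →ₗᵢ[ℝ] Euc n := L.1.subtypeₗᵢ.comp e.toLinearIsometry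
  refine ⟨Unitary.linearIsometryEquiv.symm (φ.extend.toLinearIsometryEquiv rfl), ?_⟩
  refine Subtype.ext (Submodule.eq_of_le_of_finrank_eq ?_ ?_)
  · rintro _ ⟨s, hs, rfl⟩
    have h1 : φ.extend s = φ ⟨s, hs⟩ := φ.extend_apply ⟨s, hs⟩
    have h2 : φ.extend s ∈ L.1 := by rw [h1]; exact (e ⟨s, hs⟩).2
    exact h2
  · rw [L.2]
    exact (orthAct _ (stdGrass hkn)).2

instance (n k : ℕ) : SecondCountableTopology (Grass n k) :=
  TopologicalSpace.secondCountableTopology_induced _ _ _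

instance (n k : ℕ) : T0Space (Grass n k) := by
  have h : Topology.IsEmbedding fun L : Grass n k => (L.1.starProjection : Euc n →L[ℝ] Euc n) :=
    ⟨⟨rfl⟩, fun L M h => Subtype.ext (Submodule.starProjection_inj.1 h)⟩
  exact h.t0Space

/-- A measurable surjection from a standard Borel space onto a countably separated one detects
measurability; hence the second countability and T0 instances above. -/
theorem measurable_grass_iff {n k : ℕ} (hkn : k ≤ n) {β : Type*} [MeasurableSpace β]
    {F : Grass n k → β} :
    Measurable F ↔ Measurable fun g : OrthGroup n => F (orthAct g (stdGrass hkn)) :=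
  ((continuous_orthAct (stdGrass hkn)).measurable.measurable_comp_iff_of_surjective
    (orthAct_stdGrass_surjective hkn)).symm

/-- **Cauchy–Kubota formula** for compact convex sets. -/
theorem integrable_and_quermass_eq {n k i : ℕ} (hik : i ≤ k) (hkn : k ≤ n) {K : Set (Euc n)}
    (hK : IsCompact K) (hKc : Convex ℝ K) (hne : K.Nonempty) :
    Integrable (fun L : Grass n k => quermass (k - i) (projSet L.1 K)) (grassMeasure hkn) ∧
      quermass (n - i) K = kubotaConst n k *
        ∫ L : Grass n k, quermass (k - i) (projSet L.1 K) ∂(grassMeasure hkn) := by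
  have hm : Measurable fun L : Grass n k => quermass (k - i) (projSet L.1 K) := by
    rw [measurable_grass_iff hkn]
    simp only [quermass_projSet_orthAct]
    exact measurable_quermass_shadow hkn _ hK hKc
  have hact := (continuous_orthAct (stdGrass hkn)).measurable.aemeasurable (μ := orthHaar n)
  constructor
  · refine (integrable_map_measure hm.aestronglyMeasurable hact).2 ?_
    simp only [Function.comp_def, quermass_projSet_orthAct]
    exact integrable_quermass_shadow hkn _ hK hKc
  · rw [quermass_eq_integral_shadow hik hkn hK hKc hne, grassMeasure,
      integral_map hact hm.aestronglyMeasurable]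
    simp only [quermass_projSet_orthAct]

/-! ### Superlevel sets -/

section superlevel

variable {E : Type*} [NormedAddCommGroup E] [InnerProductSpace ℝ E] {f : E → ℝ≥0∞}

theorem IsAdmissible.isCompact_superlevel (hf : IsAdmissible f) {t : ℝ} (ht : 0 < t) :
    IsCompact {x | ENNReal.ofReal t ≤ f x} := by
  have hclosed : IsClosed {x | ENNReal.ofReal t ≤ f x} :=
    hf.upperSemicontinuous.isClosed_preimage _
  have h := hf.tendsto_zero.eventually_lt_const (ENNReal.ofReal_pos.2 ht)
  obtain ⟨C, hC, hsub⟩ := mem_cocompact.1 h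
  refine hC.of_isClosed_subset hclosed fun x hx => ?_
  by_contra hxC
  have h1 : f x < ENNReal.ofReal t := hsub hxC
  exact absurd h1 (not_lt.2 hx)

theorem IsAdmissible.convex_superlevel (hf : IsAdmissible f) (t : ℝ) :
    Convex ℝ {x | ENNReal.ofReal t ≤ f x} := by
  intro x hx y hy a b ha hb hab
  have h := hf.quasiconcave x y b hb (by linarith)
  rw [← hab, add_sub_cancel_right] at h
  exact (le_min hx hy).trans h

theorem IsAdmissible.superlevel_projFun [FiniteDimensional ℝ E] (hf : IsAdmissible f) (L : Submodule ℝ E) {t : ℝ}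
    (ht : 0 < t) : {x | ENNReal.ofReal t ≤ projFun L f x} =
      projSet L {x | ENNReal.ofReal t ≤ f x} := by
  ext x
  constructor
  · intro hx
    -- The supremum is not yet known to be attained. Level t / 2 ensures that the fibre meets a
    -- compact superlevel set, on which the upper semicontinuous f has a maximum.
    have hlt : ENNReal.ofReal (t / 2) < projFun L f x :=
      ((ENNReal.ofReal_lt_ofReal_iff ht).2 (by linarith)).trans_le hx
    obtain ⟨y₀, hy₀⟩ := lt_iSup_iff.1 hlt
    have hcomp : IsCompact ({z | ENNReal.ofReal (t / 2) ≤ f z} ∩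
        L.orthogonalProjectionOnto ⁻¹' {x}) :=
      (hf.isCompact_superlevel (by linarith)).inter_right
        (isClosed_singleton.preimage L.orthogonalProjectionOnto.continuous)
    have hproj : ∀ y : Lᗮ, L.orthogonalProjectionOnto ((x : E) + (y : E)) = x := by
      intro y
      rw [map_add, Submodule.orthogonalProjectionOnto_mem_subspace_eq_self,
        Submodule.orthogonalProjectionOnto_apply_of_mem_orthogonal y.2, add_zero]
    have hne : ({z | ENNReal.ofReal (t / 2) ≤ f z} ∩ L.orthogonalProjectionOnto ⁻¹' {x}).Nonempty :=
      ⟨(x : E) + (y₀ : E), hy₀.le, hproj y₀⟩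
    obtain ⟨z, ⟨hz1, hz2⟩, hzmax⟩ := UpperSemicontinuousOn.exists_isMaxOn hne hcomp
      (hf.upperSemicontinuous.upperSemicontinuousOn _)
    refine ⟨z, ?_, hz2⟩
    refine le_trans (mem_ofPred_eq ▸ hx) (iSup_le fun y => ?_)
    rcases le_total (ENNReal.ofReal (t / 2)) (f ((x : E) + (y : E))) with h | h
    · exact hzmax ⟨h, hproj y⟩
    · exact h.trans hz1
  · rintro ⟨z, hz, rfl⟩
    have hzL : z - L.orthogonalProjectionOnto z ∈ Lᗮ := L.sub_starProjection_mem_orthogonal z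
    refine le_trans hz (le_trans (le_of_eq ?_)
      (le_iSup (fun y : Lᗮ => f ((L.orthogonalProjectionOnto z : E) + (y : E))) ⟨_, hzL⟩))
    simp

end superlevel

/-! ### Kubota's formula for functions -/

/-- The set of all `((g, t), y)` with `t > 0` and `y` in the `g`-shadow of the parallel body at
distance `r` of `{f ≥ t}` is measurable. -/
theorem measurableSet_shadow_superlevel {n k : ℕ} (hkn : k ≤ n) {f : Euc n → ℝ≥0∞}
    (hf : IsAdmissible f) (r : ℝ) :
    MeasurableSet {p : (OrthGroup n × ℝ) × Euc k | 0 < p.1.2 ∧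
      p.2 ∈ shadowMap hkn p.1.1 ''
        ({x | ENNReal.ofReal p.1.2 ≤ f x} + Metric.closedBall 0 r)} := by
  have hU : {p : (OrthGroup n × ℝ) × Euc k | 0 < p.1.2 ∧ p.2 ∈ shadowMap hkn p.1.1 ''
      ({x | ENNReal.ofReal p.1.2 ≤ f x} + Metric.closedBall 0 r)} =
      ⋃ m : ℕ, {p : (OrthGroup n × ℝ) × Euc k | 1 / ((m : ℝ) + 1) ≤ p.1.2 ∧
        p.2 ∈ shadowMap hkn p.1.1 ''
          ({x | ENNReal.ofReal p.1.2 ≤ f x} + Metric.closedBall 0 r)} := by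
    ext p
    simp only [mem_ofPred_eq, mem_iUnion]
    constructor
    · rintro ⟨h1, h2⟩
      obtain ⟨m, hm⟩ := exists_nat_one_div_lt h1
      exact ⟨m, hm.le, h2⟩
    · rintro ⟨m, h1, h2⟩
      exact ⟨lt_of_lt_of_le (by positivity) h1, h2⟩
  rw [hU]
  -- For t ≥ 1/(m+1) the points x stay in one compact superlevel set, so the set is the projection
  -- of a closed set along a compact factor. Closedness upstairs uses the closed hypograph of f.
  refine MeasurableSet.iUnion fun m => IsClosed.measurableSet ?_
  have hm : (0 : ℝ) < 1 / ((m : ℝ) + 1) := by positivity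
  set C : Set (Euc n × Euc n) :=
    {x | ENNReal.ofReal (1 / ((m : ℝ) + 1)) ≤ f x} ×ˢ Metric.closedBall 0 r with hC
  have : CompactSpace C := isCompact_iff_compactSpace.1
    ((hf.isCompact_superlevel hm).prod (isCompact_closedBall _ _))
  set B : Set (C × ((OrthGroup n × ℝ) × Euc k)) :=
    {q | 1 / ((m : ℝ) + 1) ≤ q.2.1.2 ∧ ENNReal.ofReal q.2.1.2 ≤ f q.1.1.1 ∧
      shadowMap hkn q.2.1.1 (q.1.1.1 + q.1.1.2) = q.2.2} with hB
  have hBc : IsClosed B := by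
    have ht : Continuous fun q : C × ((OrthGroup n × ℝ) × Euc k) => q.2.1.2 := by fun_prop
    refine (isClosed_le continuous_const ht).inter (IsClosed.inter ?_ ?_)
    · have h := hf.upperSemicontinuous.IsClosed_hypograph
      have hx : Continuous fun q : C × ((OrthGroup n × ℝ) × Euc k) => q.1.1.1 := by fun_prop
      exact h.preimage (hx.prodMk (ENNReal.continuous_ofReal.comp ht))
    · have hl : Continuous fun q : C × ((OrthGroup n × ℝ) × Euc k) =>
          (q.2.1.1, q.1.1.1 + q.1.1.2) := by fun_prop
      have hr : Continuous fun q : C × ((OrthGroup n × ℝ) × Euc k) => q.2.2 := by fun_prop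
      have hs := Continuous.comp (g := fun p : OrthGroup n × Euc n => shadowMap hkn p.1 p.2)
        (continuous_shadowMap_apply hkn) hl
      exact isClosed_eq hs hr
  convert isClosedMap_snd_of_compactSpace _ hBc using 1
  ext ⟨⟨g, t⟩, y⟩
  constructor
  · rintro ⟨h1, _, ⟨x, hx, b, hb, rfl⟩, hy⟩
    exact ⟨(⟨(x, b), (ENNReal.ofReal_le_ofReal h1).trans hx, hb⟩, (g, t), y), ⟨h1, hx, hy⟩, rfl⟩
  · rintro ⟨⟨⟨⟨x, b⟩, hx, hb⟩, _⟩, ⟨h1, h2, h3⟩, rfl⟩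
    exact ⟨h1, _, ⟨x, h2, b, hb, rfl⟩, h3⟩

/-- Quermassintegrals are combinations of volumes of sections of jointly measurable sets. Agreement
is claimed only for t > 0, where superlevel sets are compact. -/
theorem exists_measurable_quermass_superlevel {n k : ℕ} (hkn : k ≤ n) (j : ℕ) {f : Euc n → ℝ≥0∞}
    (hf : IsAdmissible f) : ∃ M : OrthGroup n × ℝ → ℝ≥0∞, Measurable M ∧ ∀ g t, 0 < t →
      ENNReal.ofReal (quermass j (shadowMap hkn g '' {x | ENNReal.ofReal t ≤ f x})) = M (g, t) := by
  obtain ⟨b, hb⟩ := quermass_shadowMap_image_eq_sum hkn j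
  refine ⟨fun p => ENNReal.ofReal (∑ i ∈ Finset.range (k + 1), (volume {y : Euc k | 0 < p.2 ∧
      y ∈ shadowMap hkn p.1 ''
        ({x | ENNReal.ofReal p.2 ≤ f x} + Metric.closedBall 0 (i : ℝ))}).toReal * b i), ?_, ?_⟩
  · refine ENNReal.measurable_ofReal.comp (Finset.measurable_fun_sum _ fun i _ => ?_)
    exact (measurable_measure_prodMk_left
      (measurableSet_shadow_superlevel hkn hf (i : ℝ))).ennreal_toReal.mul_const _
  · intro g t ht
    rw [hb _ (hf.isCompact_superlevel ht) (hf.convex_superlevel t)]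
    simp only [ht, true_and]
    rfl

/-- **Cauchy–Kubota formula** for quasi-concave functions. -/
theorem aemeasurable_and_quermassFun_eq {n k i : ℕ} (hik : i ≤ k) (hkn : k ≤ n)
    {f : Euc n → ℝ≥0∞} (hf : IsAdmissible f) :
    AEMeasurable (fun L : Grass n k => quermassFun (k - i) (projFun L.1 f)) (grassMeasure hkn) ∧
      quermassFun (n - i) f = ENNReal.ofReal (kubotaConst n k) *
        ∫⁻ L : Grass n k, quermassFun (k - i) (projFun L.1 f) ∂(grassMeasure hkn) := by
  obtain ⟨M, hM, hMeq⟩ := exists_measurable_quermass_superlevel hkn (k - i) hf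
  have hpull : ∀ g : OrthGroup n, quermassFun (k - i) (projFun (orthAct g (stdGrass hkn)).1 f) =
      ∫⁻ t in Ioi (0 : ℝ), M (g, t) := by
    intro g
    refine setLIntegral_congr_fun measurableSet_Ioi fun t ht => ?_
    simp only [hf.superlevel_projFun _ ht, quermass_projSet_orthAct]
    exact hMeq g t ht
  have hmeas : Measurable fun L : Grass n k => quermassFun (k - i) (projFun L.1 f) := by
    rw [measurable_grass_iff hkn]
    simp only [hpull]
    exact hM.lintegral_prod_right'
  refine ⟨hmeas.aemeasurable, ?_⟩
  have hc : 0 ≤ kubotaConst n k := div_nonneg (ballVol_pos n).le (ballVol_pos k).le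
  have hlevel : ∀ t : ℝ, 0 < t → ENNReal.ofReal (quermass (n - i) {x | ENNReal.ofReal t ≤ f x}) =
      ENNReal.ofReal (kubotaConst n k) * ∫⁻ g, M (g, t) ∂(orthHaar n) := by
    intro t ht
    have hK := hf.isCompact_superlevel ht
    have hKc := hf.convex_superlevel t
    simp only [← hMeq _ t ht]
    rcases {x | ENNReal.ofReal t ≤ f x}.eq_empty_or_nonempty with h | h
    -- An empty superlevel set contributes zero to both sides.
    · simp [h, quermass_empty]
    · rw [quermass_eq_integral_shadow hik hkn hK hKc h, ENNReal.ofReal_mul hc,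
        ofReal_integral_eq_lintegral_ofReal (integrable_quermass_shadow hkn _ hK hKc)
          (Eventually.of_forall fun g => quermass_nonneg _ (shadowMap_image_isCompact hkn g hK)
            (shadowMap_image_convex hkn g hKc))]
  rw [grassMeasure, lintegral_map hmeas (continuous_orthAct (stdGrass hkn)).measurable]
  simp only [hpull]
  -- Tonelli moves the level integral outside, where the formula for sets applies for each t.
  rw [lintegral_lintegral_swap (f := fun g t => M (g, t)) hM.aemeasurable, quermassFun,
    setLIntegral_congr_fun measurableSet_Ioi hlevel,
    lintegral_const_mul _ hM.lintegral_prod_left']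

end Kubota

end

theorem theorem5p3 (n k i : ℕ) (hik : i ≤ k) (hk : 1 ≤ k) (hkn : k ≤ n) :
    (∀ K : ConvexBody (EuclideanSpace ℝ (Fin n)),
      Integrable (fun L : Kubota.Grass n k =>
        Kubota.quermass (k - i) (Kubota.projSet L.1 (K : Set (EuclideanSpace ℝ (Fin n)))))
        (Kubota.grassMeasure hkn) ∧
      Kubota.quermass (n - i) (K : Set (EuclideanSpace ℝ (Fin n))) =
        Kubota.kubotaConst n k * ∫ L : Kubota.Grass n k,
          Kubota.quermass (k - i) (Kubota.projSet L.1 (K : Set (EuclideanSpace ℝ (Fin n))))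
          ∂(Kubota.grassMeasure hkn)) ∧
    ∀ f : EuclideanSpace ℝ (Fin n) → ℝ≥0∞, Kubota.IsAdmissible f →
      AEMeasurable (fun L : Kubota.Grass n k =>
        Kubota.quermassFun (k - i) (Kubota.projFun L.1 f)) (Kubota.grassMeasure hkn) ∧
      Kubota.quermassFun (n - i) f =
        ENNReal.ofReal (Kubota.kubotaConst n k) * ∫⁻ L : Kubota.Grass n k,
          Kubota.quermassFun (k - i) (Kubota.projFun L.1 f) ∂(Kubota.grassMeasure hkn) := by
  refine ⟨fun K => ?_, fun f hf => Kubota.aemeasurable_and_quermassFun_eq hik hkn hf⟩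
  exact Kubota.integrable_and_quermass_eq hik hkn K.isCompact K.convex K.nonempty
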